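/- For positive integers $n,H$ let $\mathcal M_n(\mathbb Z;H)$ be the set of $n\times n$ integer matrices all of whose entries have absolute value at most $H$, and for $m\ge 1$ let $$\mathcal W_{m,n}(\mathbb Z;H)=\{A_1\cdots A_m : A_1,\dots,A_m\in\mathcal M_n(\mathbb Z;H)\}.$$ Fix integers $m,n\ge 2$. All asymptotic notation refers to positive integers $H\to\infty$ with $m,n$ fixed; in particular $o(1)$ and the constant implied by $O$ may depend on $m$ and $n$. Then: 1. $\#\mathcal W_{m,n}(\mathbb Z;H)\ \ge\ H^{\,n^2+mn-n+o(1)}$. 2. With $\rho=m^{1/(m-1)}$ and $Q(u)=u\log u-u+1$, $$\#\mathcal W_{m,n}(\mathbb Z;H)=O\!\left(\frac{H^{mn^2}}{(\log H)^{Q(1/\log\rho)-1}\,(\log\log H)^{3/2}}\right).$$ 3. If moreover $m\ge 6$, then $\#\mathcal W_{m,n}(\mathbb Z;H)=o\!\left(H^{mn^2}\right)$. -/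

import Mathlib

open Filter Topology Asymptotics

/-- The set of `n × n` integer matrices all of whose entries have absolute value at most `H`. -/
def boundedMatrices (n H : ℕ) : Set (Matrix (Fin n) (Fin n) ℤ) :=
  {A | ∀ i j, |A i j| ≤ (H : ℤ)}

/-- The set of all ordered products `A₁ ⋯ Aₘ` of `m` matrices with entries bounded by `H`. -/
def productSet (m n H : ℕ) : Set (Matrix (Fin n) (Fin n) ℤ) :=
  {C | ∃ A : Fin m → Matrix (Fin n) (Fin n) ℤ,
    (∀ i, A i ∈ boundedMatrices n H) ∧ (List.ofFn A).prod = C}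

theorem boundedMatrices_finite (n H : ℕ) : (boundedMatrices n H).Finite := by
  have h : (Set.pi Set.univ fun _ : Fin n =>
      Set.pi Set.univ fun _ : Fin n => Set.Icc (-(H : ℤ)) H).Finite :=
    Set.Finite.pi fun _ => Set.Finite.pi fun _ => Set.finite_Icc _ _
  refine h.subset fun A hA => ?_
  intro i _ j _
  exact abs_le.mp (hA i j)

/-- The product set is finite, so that `Set.ncard` is its true number of elements. -/
theorem productSet_finite (m n H : ℕ) : (productSet m n H).Finite := by
  have h : (Set.pi Set.univ fun _ : Fin m => boundedMatrices n H).Finite :=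
    Set.Finite.pi fun _ => boundedMatrices_finite n H
  refine (h.image fun A => (List.ofFn A).prod).subset ?_
  rintro C ⟨A, hA, rfl⟩
  exact ⟨A, fun i _ => hA i, rfl⟩

/-- The function `Q(u) = u log u - u + 1`. -/
noncomputable def logEntropy (u : ℝ) : ℝ :=
  u * Real.log u - u + 1

/-- The number `ρ = m ^ (1 / (m - 1))`, for `m ≥ 2`. -/
noncomputable def rhoConst (m : ℕ) : ℝ :=
  (m : ℝ) ^ ((1 : ℝ) / ((m : ℝ) - 1))

/-!
The lower bound comes from the products `M * D` with `D` diagonal. The entries of `D` run over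
products of `m - 1` distinct primes up to `H`, and the first row of `M` over primes from a disjoint
set, so that the factorization of the first row of `M * D` recovers `D` and then `M`. By Chebyshev's
bound for the number of primes there are `H ^ (n ^ 2 + m n - n + o(1))` such pairs
(`card_le_ncard_productSet`, `eventually_rpow_le_ncard_productSet`).

The upper bound is Erdős's argument for the multiplication table, applied to determinants. Write
`L = log log H`, `u = 1 / log ρ = (m - 1) / log m`, and let `ω(A)` be the number of prime divisors
of `det A` in the range from a power of `log H` to `exp (log H / L ^ 2)`. These primes still have
reciprocal sum `L + O(log L)`, they are so large that rarely two of the factors have determinants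
with a common one, and they are so small that products of `O(L)` of them stay below `√H`. If no
prime is shared, then `ω(A₁ ⋯ Aₘ) = ω(A₁) + ⋯ + ω(Aₘ)`, so that a product either has `ω ≥ u L` or
comes from a tuple with `∑ ω(Aᵢ) ≤ u L` (`ncard_productSet_le_add`).

A matrix is singular modulo `p` with probability `1 / p + O(1 / p ^ 2)`, and by the Chinese
remainder theorem the matrices of a box behave independently for several primes, up to a small
relative error as long as the product of the primes is small compared with the side of the box
(`abs_card_det_dvd_sub_le`). Hence `ω` is nearly Poisson with mean `L`, on the box that contains the
products as well as on the box of the factors. Truncated binomial moments make this precise: for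
`z ≥ 1` the terms are positive and may be dropped, for `z ≤ 1` the Bonferroni inequalities apply
(`NearlyIndependent.card_large_mul_pow_le`, `NearlyIndependent.sum_pow_card_le`). Rankin's trick
with `z = u` on the products and with `z = u / m` on the factors bounds both cases by
`H ^ (m n ^ 2) (log H) ^ (-Q(u) + o(1))`, the same exponent because `u log m = m - 1`. The bound to
be shown has the exponent `1 - Q(u)` instead, so half a power of `log H` is given away to avoid a
precise treatment of `o(1)` and of the power of `log log H`.

Both halves of Mertens' theorem on `∑ 1 / p` enter (`exists_sum_inv_primesLE_le`,
`exists_le_sum_inv_primesLE`). For `m ≥ 6` one has `u ≥ e`, whence `Q(u) ≥ 1`.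
-/

/-! ### Mertens' estimate for the sum of the reciprocals of the primes -/

theorem sum_log_primeFactors_le {n : ℕ} (hn : n ≠ 0) :
    ∑ p ∈ n.primeFactors, Real.log p ≤ Real.log n := by
  rw [← Real.log_prod (fun p hp => by
    have := (Nat.prime_of_mem_primeFactors hp).pos
    positivity)]
  have h := Nat.le_of_dvd (Nat.pos_of_ne_zero hn) (Nat.prod_primeFactors_dvd n)
  apply Real.log_le_log
  · exact Finset.prod_pos fun p hp => by
      have := (Nat.prime_of_mem_primeFactors hp).pos
      positivity
  · have h' : ((∏ p ∈ n.primeFactors, p : ℕ) : ℝ) ≤ n := Nat.cast_le.mpr h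
    rwa [Nat.cast_prod] at h'

/-- The half of Mertens' first theorem that is needed. Counting multiples,
`∑ p, ⌊N / p⌋ log p ≤ log N! ≤ N log N`, and Chebyshev's bound for `θ` absorbs the floors. -/
theorem sum_log_div_primesLE_le {N : ℕ} (hN : 1 ≤ N) :
    ∑ p ∈ N.primesLE, Real.log p / p ≤ Real.log N + Real.log 4 := by
  have hN' : (0 : ℝ) < N := by positivity
  have h1 : ∑ p ∈ N.primesLE, ((N / p : ℕ) : ℝ) * Real.log p ≤ N * Real.log N := by
    calc ∑ p ∈ N.primesLE, ((N / p : ℕ) : ℝ) * Real.log p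
        = ∑ p ∈ N.primesLE, ∑ k ∈ Finset.range N, if p ∣ k + 1 then Real.log p else 0 := by
          refine Finset.sum_congr rfl fun p _ => ?_
          rw [← Finset.sum_filter, Finset.sum_const, Nat.card_multiples, nsmul_eq_mul]
      _ = ∑ k ∈ Finset.range N, ∑ p ∈ N.primesLE, if p ∣ k + 1 then Real.log p else 0 :=
          Finset.sum_comm
      _ ≤ ∑ k ∈ Finset.range N, Real.log N := by
          refine Finset.sum_le_sum fun k hk => ?_
          have hk' : k + 1 ≤ N := Finset.mem_range.mp hk
          have : (N.primesLE.filter fun p => p ∣ k + 1) = (k + 1).primeFactors := by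
            ext p
            simp only [Finset.mem_filter, Nat.mem_primesLE, Nat.mem_primeFactors]
            constructor
            · rintro ⟨⟨_, hp⟩, hd⟩
              exact ⟨hp, hd, by omega⟩
            · rintro ⟨hp, hd, _⟩
              exact ⟨⟨(Nat.le_of_dvd (by omega) hd).trans hk', hp⟩, hd⟩
          rw [← Finset.sum_filter, this]
          refine (sum_log_primeFactors_le (by omega)).trans ?_
          exact Real.log_le_log (by positivity) (by exact_mod_cast hk')
      _ = N * Real.log N := by simp
  have h2 : ∑ p ∈ N.primesLE, Real.log p ≤ Real.log 4 * N := by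
    rw [← Chebyshev.theta_eq_sum_primesLE_log]
    exact Chebyshev.theta_le_log4_mul_x hN'.le
  have h3 : N * ∑ p ∈ N.primesLE, Real.log p / p ≤
      ∑ p ∈ N.primesLE, ((N / p : ℕ) : ℝ) * Real.log p + ∑ p ∈ N.primesLE, Real.log p := by
    rw [Finset.mul_sum, ← Finset.sum_add_distrib]
    refine Finset.sum_le_sum fun p hp => ?_
    have hp0 : 0 < p := (Nat.mem_primesLE.mp hp).2.pos
    have hlog : 0 ≤ Real.log p := Real.log_natCast_nonneg p
    have : (N : ℝ) / p ≤ ((N / p : ℕ) : ℝ) + 1 := by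
      rw [← Nat.floor_div_eq_div (K := ℝ)]
      exact (Nat.lt_floor_add_one _).le
    calc (N : ℝ) * (Real.log p / p) = (N / p) * Real.log p := by ring
      _ ≤ (((N / p : ℕ) : ℝ) + 1) * Real.log p := by gcongr
      _ = _ := by ring
  have h4 : N * ∑ p ∈ N.primesLE, Real.log p / p ≤ N * (Real.log N + Real.log 4) := by
    linarith
  exact le_of_mul_le_mul_left h4 hN'

theorem primesLE_succ_sum (f : ℕ → ℝ) (N : ℕ) :
    ∑ p ∈ (N + 1).primesLE, f p =
      ∑ p ∈ N.primesLE, f p + if (N + 1).Prime then f (N + 1) else 0 := by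
  have : (N + 1).primesLE =
      if (N + 1).Prime then insert (N + 1) N.primesLE else N.primesLE := by
    ext p
    split_ifs with h
    · simp only [Nat.mem_primesLE, Finset.mem_insert]
      constructor
      · rintro ⟨h1, h2⟩
        rcases Nat.lt_or_ge N p with h3 | h3
        · left; omega
        · right; exact ⟨h3, h2⟩
      · rintro (rfl | ⟨h1, h2⟩)
        · exact ⟨le_rfl, h⟩
        · exact ⟨by omega, h2⟩
    · simp only [Nat.mem_primesLE]
      constructor
      · rintro ⟨h1, h2⟩
        refine ⟨?_, h2⟩
        by_contra h3
        exact h ((by omega : p = N + 1) ▸ h2)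
      · rintro ⟨h1, h2⟩
        exact ⟨by omega, h2⟩
  rw [this]
  split_ifs with h
  · rw [Finset.sum_insert (by simp [Nat.mem_primesLE]), add_comm]
  · simp

theorem sum_inv_primesLE_le_aux {N : ℕ} (hN : 2 ≤ N) :
    ∑ p ∈ N.primesLE, (1 : ℝ) / p ≤
      (∑ p ∈ N.primesLE, Real.log p / p - Real.log 4) / Real.log N +
        Real.log (Real.log N) + (2 - Real.log (Real.log 2)) := by
  induction N, hN using Nat.le_induction with
  | base =>
    have h2 : (2 : ℕ).primesLE = {2} := by decide
    have hl : 0 < Real.log 2 := Real.log_pos (by norm_num)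
    have h4 : Real.log 4 = 2 * Real.log 2 := by
      rw [show (4 : ℝ) = 2 ^ 2 by norm_num, Real.log_pow]; norm_num
    rw [h2, Finset.sum_singleton, Finset.sum_singleton]
    push_cast
    rw [h4]
    have : (Real.log 2 / 2 - 2 * Real.log 2) / Real.log 2 = -(3 / 2) := by
      field_simp; norm_num
    rw [this]
    linarith
  | succ N hN ih =>
    have hl : 0 < Real.log N := Real.log_pos (by exact_mod_cast (by omega : 1 < N))
    have hl' : 0 < Real.log ((N + 1 : ℕ) : ℝ) :=
      Real.log_pos (by exact_mod_cast (by omega : 1 < N + 1))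
    have hA := sum_log_div_primesLE_le (N := N) (by omega)
    set a := ∑ p ∈ N.primesLE, Real.log p / p with ha
    set l := Real.log N
    set l' := Real.log ((N + 1 : ℕ) : ℝ)
    have hll : l ≤ l' := Real.log_le_log (by positivity) (by push_cast; linarith)
    have hstep : (a - Real.log 4) / l ≤ (a - Real.log 4) / l' + (1 - l / l') := by
      have : (a - Real.log 4) * (1 / l - 1 / l') ≤ l * (1 / l - 1 / l') := by
        apply mul_le_mul_of_nonneg_right (by linarith)
        have := one_div_le_one_div_of_le hl hll
        linarith
      have e : l * (1 / l - 1 / l') = 1 - l / l' := by field_simp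
      rw [e] at this
      calc (a - Real.log 4) / l
          = (a - Real.log 4) / l' + (a - Real.log 4) * (1 / l - 1 / l') := by ring
        _ ≤ _ := by linarith
    have hlog : 1 - l / l' ≤ Real.log l' - Real.log l := by
      have := Real.one_sub_inv_le_log_of_pos (x := l' / l) (by positivity)
      rwa [inv_div, Real.log_div hl'.ne' hl.ne'] at this
    have hsum : ∑ p ∈ (N + 1).primesLE, Real.log p / p =
        a + if (N + 1).Prime then l' / ((N + 1 : ℕ) : ℝ) else 0 :=
      primesLE_succ_sum (fun p => Real.log p / p) N
    rw [primesLE_succ_sum (fun p => 1 / (p : ℝ)) N, hsum]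
    have e2 : (a + (if (N + 1).Prime then l' / ((N + 1 : ℕ) : ℝ) else 0) - Real.log 4) / l' =
        (a - Real.log 4) / l' + if (N + 1).Prime then 1 / ((N + 1 : ℕ) : ℝ) else 0 := by
      split_ifs
      · field_simp; ring
      · simp
    rw [e2]
    linarith

/-- The upper half of Mertens' second theorem, by partial summation. -/
theorem exists_sum_inv_primesLE_le :
    ∃ C : ℝ, ∀ N : ℕ, 2 ≤ N → ∑ p ∈ N.primesLE, (1 : ℝ) / p ≤ Real.log (Real.log N) + C := by
  refine ⟨1 + (2 - Real.log (Real.log 2)), fun N hN => ?_⟩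
  have hl : 0 < Real.log N := Real.log_pos (by exact_mod_cast (by omega : 1 < N))
  have h1 := sum_inv_primesLE_le_aux hN
  have h2 : (∑ p ∈ N.primesLE, Real.log p / p - Real.log 4) / Real.log N ≤ 1 := by
    rw [div_le_one hl]
    linarith [sum_log_div_primesLE_le (N := N) (by omega)]
  linarith

theorem sum_inv_mul_pred_le (N : ℕ) :
    ∑ p ∈ N.primesLE, (1 : ℝ) / (p * (p - 1)) ≤ 1 := by
  have h : ∀ M : ℕ, ∑ k ∈ Finset.Icc 2 (M + 1), (1 : ℝ) / (k * (k - 1)) ≤ 1 - 1 / (M + 1) := by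
    intro M
    induction M with
    | zero => simp
    | succ M ih =>
      rw [Finset.sum_Icc_succ_top (by omega)]
      refine (add_le_add_left ih _).trans (le_of_eq ?_)
      push_cast
      field_simp
      ring
  calc ∑ p ∈ N.primesLE, (1 : ℝ) / (p * (p - 1))
      ≤ ∑ k ∈ Finset.Icc 2 (N + 1), (1 : ℝ) / (k * (k - 1)) := by
        apply Finset.sum_le_sum_of_subset_of_nonneg
        · intro p hp
          have := Nat.mem_primesLE.mp hp
          exact Finset.mem_Icc.mpr ⟨this.2.two_le, by omega⟩
        · intro k hk _
          have h2 : (2 : ℝ) ≤ k := by exact_mod_cast (Finset.mem_Icc.mp hk).1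
          have : (0 : ℝ) ≤ k - 1 := by linarith
          positivity
    _ ≤ 1 - 1 / (N + 1) := h N
    _ ≤ 1 := by
        have : (0 : ℝ) ≤ 1 / (N + 1) := by positivity
        linarith

/-- The Euler product over the primes up to `N` dominates the harmonic sum. -/
theorem log_le_prod_primesLE {N : ℕ} (hN : 1 ≤ N) :
    Real.log N ≤ ∏ p ∈ N.primesLE, (1 - (p : ℝ)⁻¹)⁻¹ := by
  let f : ℕ →* ℝ :=
    { toFun := fun n => (n : ℝ)⁻¹
      map_one' := by simp
      map_mul' := fun a b => by push_cast; rw [mul_inv] }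
  obtain ⟨hs, hS⟩ := EulerProduct.summable_and_hasSum_smoothNumbers_prod_primesBelow_geometric
    (f := f) (fun {p} hp => by
      have h2 : (2 : ℝ) ≤ p := by exact_mod_cast hp.two_le
      change ‖(p : ℝ)⁻¹‖ < 1
      rw [Real.norm_of_nonneg (by positivity)]
      exact inv_lt_one_of_one_lt₀ (by linarith)) (N + 1)
  have e : ∏ p ∈ N.primesLE, (1 - (p : ℝ)⁻¹)⁻¹ = ∏ p ∈ (N + 1).primesBelow, (1 - f p)⁻¹ := rfl
  rw [e, ← hS.tsum_eq]
  let g : ℕ → (N + 1).smoothNumbers := fun k =>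
    if h : k + 1 < N + 1 then ⟨k + 1, Nat.mem_smoothNumbers_of_lt (by omega) h⟩
    else ⟨1, Nat.mem_smoothNumbers_of_lt (by omega) (by omega)⟩
  have hg : ∀ k ∈ Finset.range N, ((g k : ℕ)) = k + 1 := by
    intro k hk
    have : k + 1 < N + 1 := by simpa using hk
    simp only [g, dif_pos this]
  have hinj : Set.InjOn g (Finset.range N : Finset ℕ) := by
    intro a ha b hb hab
    have := congrArg (fun x : (N + 1).smoothNumbers => (x : ℕ)) hab
    simp only [hg a ha, hg b hb] at this
    omega
  calc Real.log N ≤ Real.log ((N + 1 : ℕ) : ℝ) :=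
        Real.log_le_log (by positivity) (by push_cast; linarith)
    _ ≤ ((harmonic N : ℚ) : ℝ) := log_add_one_le_harmonic N
    _ = ∑ k ∈ Finset.range N, f (g k) := by
        rw [harmonic]
        push_cast
        refine Finset.sum_congr rfl fun k hk => ?_
        rw [hg k hk]
        change _ = (((k + 1 : ℕ)) : ℝ)⁻¹
        push_cast; rfl
    _ = ∑ m ∈ (Finset.range N).image g, f m := by
        rw [Finset.sum_image hinj]
    _ ≤ ∑' m : (N + 1).smoothNumbers, f m := by
        apply hS.summable.sum_le_tsum
        intro i _
        change 0 ≤ ((i : ℕ) : ℝ)⁻¹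
        positivity

/-- The lower half of Mertens' second theorem. -/
theorem exists_le_sum_inv_primesLE :
    ∃ C : ℝ, ∀ N : ℕ, 2 ≤ N → Real.log (Real.log N) - C ≤ ∑ p ∈ N.primesLE, (1 : ℝ) / p := by
  refine ⟨1, fun N hN => ?_⟩
  have hl : 0 < Real.log N := Real.log_pos (by exact_mod_cast (by omega : 1 < N))
  have h1 : Real.log (Real.log N) ≤ ∑ p ∈ N.primesLE, Real.log (1 - (p : ℝ)⁻¹)⁻¹ := by
    rw [← Real.log_prod]
    · exact Real.log_le_log hl (log_le_prod_primesLE (by omega))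
    · intro p hp
      have h2 : (2 : ℝ) ≤ p := by exact_mod_cast (Nat.mem_primesLE.mp hp).2.two_le
      have : (p : ℝ)⁻¹ < 1 := inv_lt_one_of_one_lt₀ (by linarith)
      exact inv_ne_zero (by linarith)
  have h2 : ∑ p ∈ N.primesLE, Real.log (1 - (p : ℝ)⁻¹)⁻¹ ≤
      ∑ p ∈ N.primesLE, ((1 : ℝ) / p + 1 / (p * (p - 1))) := by
    refine Finset.sum_le_sum fun p hp => ?_
    have h2 : (2 : ℝ) ≤ p := by exact_mod_cast (Nat.mem_primesLE.mp hp).2.two_le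
    have h3 : (p : ℝ)⁻¹ < 1 := inv_lt_one_of_one_lt₀ (by linarith)
    have h4 : (0 : ℝ) < p - 1 := by linarith
    refine (Real.log_le_sub_one_of_pos (inv_pos.mpr (by linarith))).trans (le_of_eq ?_)
    have e : 1 - (p : ℝ)⁻¹ = (p - 1) / p := by field_simp
    rw [e, inv_div]
    field_simp
    ring
  rw [Finset.sum_add_distrib] at h2
  linarith [sum_inv_mul_pred_le N]

/-! ### Singular matrices modulo squarefree numbers -/

/-- The proportion of singular matrices among all `n × n` matrices over `ℤ/qℤ`. -/
noncomputable def singularDensity (n q : ℕ) : ℝ :=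
  (Nat.card {A : Matrix (Fin n) (Fin n) (ZMod q) // A.det = 0} : ℝ) / (q : ℝ) ^ (n ^ 2)

theorem singularDensity_nonneg (n q : ℕ) : 0 ≤ singularDensity n q := by
  unfold singularDensity; positivity

theorem singularDensity_one (n : ℕ) : singularDensity n 1 = 1 := by
  have : Nat.card {A : Matrix (Fin n) (Fin n) (ZMod 1) // A.det = 0} = 1 := by
    rw [Nat.card_eq_one_iff_unique]
    exact ⟨⟨fun a b => Subtype.ext (Subsingleton.elim (α := Fin n → Fin n → Fin 1) _ _)⟩,
      ⟨⟨0, Subsingleton.elim (α := Fin 1) _ _⟩⟩⟩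
  unfold singularDensity
  rw [this]
  simp

/-- Chinese remainder theorem. -/
theorem singularDensity_mul (n : ℕ) {a b : ℕ} (h : a.Coprime b) :
    singularDensity n (a * b) = singularDensity n a * singularDensity n b := by
  let e := ZMod.chineseRemainder h
  let E : Matrix (Fin n) (Fin n) (ZMod (a * b)) ≃
      Matrix (Fin n) (Fin n) (ZMod a) × Matrix (Fin n) (Fin n) (ZMod b) :=
    { toFun := fun A => (A.map fun x => (e x).1, A.map fun x => (e x).2)
      invFun := fun P => Matrix.of fun i j => e.symm (P.1 i j, P.2 i j)
      left_inv := fun A => by ext i j; simp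
      right_inv := fun P => by
        refine Prod.ext ?_ ?_ <;> ext i j <;> simp }
  have hE : ∀ A : Matrix (Fin n) (Fin n) (ZMod (a * b)),
      A.det = 0 ↔ (E A).1.det = 0 ∧ (E A).2.det = 0 := by
    intro A
    have h1 : (E A).1.det = (e A.det).1 :=
      (RingHom.map_det ((RingHom.fst _ _).comp e.toRingHom) A).symm
    have h2 : (E A).2.det = (e A.det).2 :=
      (RingHom.map_det ((RingHom.snd _ _).comp e.toRingHom) A).symm
    rw [h1, h2, ← map_eq_zero_iff e e.injective, Prod.ext_iff]
    rfl
  have hcard : Nat.card {A : Matrix (Fin n) (Fin n) (ZMod (a * b)) // A.det = 0} =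
      Nat.card {A : Matrix (Fin n) (Fin n) (ZMod a) // A.det = 0} *
        Nat.card {A : Matrix (Fin n) (Fin n) (ZMod b) // A.det = 0} := by
    rw [← Nat.card_prod]
    exact Nat.card_congr ((E.subtypeEquiv hE).trans
      (Equiv.subtypeProdEquivProd (p := fun A : Matrix (Fin n) (Fin n) (ZMod a) => A.det = 0)
        (q := fun B : Matrix (Fin n) (Fin n) (ZMod b) => B.det = 0)))
  unfold singularDensity
  rw [hcard]
  push_cast
  rw [mul_pow, mul_div_mul_comm]

theorem singularDensity_prod (n : ℕ) (D : Finset ℕ) (hD : ∀ p ∈ D, p.Prime) :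
    singularDensity n (∏ p ∈ D, p) = ∏ p ∈ D, singularDensity n p := by
  induction D using Finset.induction_on with
  | empty => simp [singularDensity_one]
  | insert p D hp ih =>
    rw [Finset.prod_insert hp, Finset.prod_insert hp, singularDensity_mul, ih]
    · exact fun q hq => hD q (Finset.mem_insert_of_mem hq)
    · refine Nat.Coprime.prod_right fun q hq => ?_
      rw [Nat.coprime_primes (hD p (Finset.mem_insert_self _ _))
        (hD q (Finset.mem_insert_of_mem hq))]
      rintro rfl
      exact hp hq

theorem one_sub_sum_le_prod_one_sub {ι : Type*} (s : Finset ι) (x : ι → ℝ)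
    (h0 : ∀ i ∈ s, 0 ≤ x i) (h1 : ∀ i ∈ s, x i ≤ 1) :
    1 - ∑ i ∈ s, x i ≤ ∏ i ∈ s, (1 - x i) := by
  classical
  induction s using Finset.induction_on with
  | empty => simp
  | insert a s ha ih =>
    rw [Finset.sum_insert ha, Finset.prod_insert ha]
    have ih' := ih (fun i hi => h0 i (Finset.mem_insert_of_mem hi))
      (fun i hi => h1 i (Finset.mem_insert_of_mem hi))
    have a0 := h0 a (Finset.mem_insert_self _ _)
    have a1 := h1 a (Finset.mem_insert_self _ _)
    have hs : 0 ≤ ∑ i ∈ s, x i :=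
      Finset.sum_nonneg fun i hi => h0 i (Finset.mem_insert_of_mem hi)
    nlinarith [mul_nonneg a0 hs, mul_le_mul_of_nonneg_left ih' (sub_nonneg.mpr a1)]

theorem singularDensity_prime (n : ℕ) {p : ℕ} (hp : p.Prime) :
    singularDensity n p = 1 - ∏ i : Fin n, (1 - ((p : ℝ)⁻¹) ^ (n - (i : ℕ))) := by
  have : Fact p.Prime := ⟨hp⟩
  have hp0 : (p : ℝ) ≠ 0 := by exact_mod_cast hp.ne_zero
  have hGL : Nat.card {A : Matrix (Fin n) (Fin n) (ZMod p) // ¬ A.det = 0} =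
      Nat.card (GL (Fin n) (ZMod p)) := by
    have : {A : Matrix (Fin n) (Fin n) (ZMod p) | ¬ A.det = 0} =
        Set.range (fun U : GL (Fin n) (ZMod p) => (U : Matrix (Fin n) (Fin n) (ZMod p))) := by
      ext A
      rw [Set.mem_ofPred_eq, ← ne_eq, ← isUnit_iff_ne_zero, ← Matrix.isUnit_iff_isUnit_det]
      rfl
    rw [← Nat.card_range_of_injective (f := fun U : GL (Fin n) (ZMod p) =>
      (U : Matrix (Fin n) (Fin n) (ZMod p))) Units.val_injective, ← this]
    rfl
  have htot : Nat.card {A : Matrix (Fin n) (Fin n) (ZMod p) // A.det = 0} +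
      Nat.card {A : Matrix (Fin n) (Fin n) (ZMod p) // ¬ A.det = 0} = p ^ (n ^ 2) := by
    classical
    rw [← Nat.card_sum, Nat.card_congr (Equiv.sumCompl _)]
    change Nat.card (Fin n → Fin n → ZMod p) = _
    simp [Nat.card_eq_fintype_card, ZMod.card, ← pow_mul, sq]
  rw [hGL, Matrix.card_GL_field, ZMod.card] at htot
  have hreal : ((∏ i : Fin n, (p ^ n - p ^ (i : ℕ)) : ℕ) : ℝ) =
      (p : ℝ) ^ (n ^ 2) * ∏ i : Fin n, (1 - ((p : ℝ)⁻¹) ^ (n - (i : ℕ))) := by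
    have e : (p : ℝ) ^ (n ^ 2) = ∏ _i : Fin n, (p : ℝ) ^ n := by
      simp [← pow_mul, sq]
    rw [e, ← Finset.prod_mul_distrib, Nat.cast_prod]
    refine Finset.prod_congr rfl fun i _ => ?_
    rw [Nat.cast_sub (Nat.pow_le_pow_right hp.pos i.2.le)]
    push_cast
    have : (p : ℝ) ^ n = (p : ℝ) ^ (n - (i : ℕ)) * (p : ℝ) ^ (i : ℕ) := by
      rw [← pow_add, Nat.sub_add_cancel i.2.le]
    rw [mul_sub, mul_one, inv_pow, this]
    field_simp
  have htot' : (Nat.card {A : Matrix (Fin n) (Fin n) (ZMod p) // A.det = 0} : ℝ) +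
      ((∏ i : Fin n, (p ^ n - p ^ (i : ℕ)) : ℕ) : ℝ) = (p : ℝ) ^ (n ^ 2) := by
    exact_mod_cast htot
  rw [hreal] at htot'
  unfold singularDensity
  rw [div_eq_iff (pow_ne_zero _ hp0)]
  linarith

theorem one_div_le_singularDensity {n p : ℕ} (hn : 1 ≤ n) (hp : p.Prime) :
    1 / (p : ℝ) ≤ singularDensity n p := by
  rw [singularDensity_prime n hp]
  have hp1 : (1 : ℝ) ≤ p := by exact_mod_cast hp.one_le
  have hx0 : 0 ≤ (p : ℝ)⁻¹ := by positivity
  have hx1 : (p : ℝ)⁻¹ ≤ 1 := inv_le_one_of_one_le₀ hp1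
  obtain ⟨k, rfl⟩ : ∃ k, n = k + 1 := ⟨n - 1, by omega⟩
  rw [Fin.prod_univ_castSucc]
  have h1 : ∏ i : Fin k, (1 - ((p : ℝ)⁻¹) ^ (k + 1 - ((Fin.castSucc i : Fin (k + 1)) : ℕ))) ≤ 1 :=
    Finset.prod_le_one (fun i _ => sub_nonneg.mpr (pow_le_one₀ hx0 hx1))
      (fun i _ => sub_le_self _ (by positivity))
  have h2 : ((p : ℝ)⁻¹) ^ (k + 1 - ((Fin.last k : Fin (k + 1)) : ℕ)) = (p : ℝ)⁻¹ := by simp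
  rw [h2, one_div]
  nlinarith [mul_le_mul_of_nonneg_right h1 (sub_nonneg.mpr hx1)]

theorem singularDensity_prime_le {n p : ℕ} (hp : p.Prime) :
    singularDensity n p ≤ 1 / (p : ℝ) + 2 / (p : ℝ) ^ 2 := by
  rw [singularDensity_prime n hp]
  have hp2 : (2 : ℝ) ≤ p := by exact_mod_cast hp.two_le
  have hx0 : 0 ≤ (p : ℝ)⁻¹ := by positivity
  have hx1 : (p : ℝ)⁻¹ ≤ 1 / 2 := by
    rw [one_div]; exact inv_anti₀ (by norm_num) hp2
  have h1 := one_sub_sum_le_prod_one_sub (Finset.univ : Finset (Fin n))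
    (fun i => ((p : ℝ)⁻¹) ^ (n - (i : ℕ))) (fun i _ => by positivity)
    (fun i _ => pow_le_one₀ hx0 (by linarith))
  have h2 : ∑ i : Fin n, ((p : ℝ)⁻¹) ^ (n - (i : ℕ)) =
      (p : ℝ)⁻¹ * ∑ i ∈ Finset.range n, ((p : ℝ)⁻¹) ^ i := by
    rw [Fin.sum_univ_eq_sum_range (fun i => ((p : ℝ)⁻¹) ^ (n - i)), Finset.mul_sum,
      ← Finset.sum_range_reflect]
    refine Finset.sum_congr rfl fun i hi => ?_
    have : i < n := Finset.mem_range.mp hi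
    rw [← pow_succ']
    congr 1
    omega
  have h3 : ∑ i ∈ Finset.range n, ((p : ℝ)⁻¹) ^ i ≤ 1 + 2 * (p : ℝ)⁻¹ := by
    rw [geom_sum_eq (by linarith)]
    have hx : 0 ≤ ((p : ℝ)⁻¹) ^ n := by positivity
    rw [← neg_div_neg_eq, div_le_iff₀ (by linarith)]
    nlinarith
  have h4 := mul_le_mul_of_nonneg_left h3 hx0
  have h5 : 1 / (p : ℝ) + 2 / (p : ℝ) ^ 2 = (p : ℝ)⁻¹ * (1 + 2 * (p : ℝ)⁻¹) := by
    field_simp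
  linarith

/-! ### Matrices in a box with determinant divisible by a given integer -/

/-- The finset of the integer matrices whose `(i, j)` entry lies in `s i j`. -/
noncomputable def entryBox {n : ℕ} (s : Fin n → Fin n → Finset ℤ) :
    Finset (Matrix (Fin n) (Fin n) ℤ) :=
  (Fintype.piFinset fun i => Fintype.piFinset (s i) : Finset (Fin n → Fin n → ℤ))

theorem mem_entryBox {n : ℕ} {s : Fin n → Fin n → Finset ℤ} {A : Matrix (Fin n) (Fin n) ℤ} :
    A ∈ entryBox s ↔ ∀ i j, A i j ∈ s i j :=
  (Fintype.mem_piFinset (t := fun i => Fintype.piFinset (s i))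
    (f := (A : Fin n → Fin n → ℤ))).trans
    (forall_congr' fun _ => Fintype.mem_piFinset)

theorem card_entryBox {n : ℕ} (s : Fin n → Fin n → Finset ℤ) :
    (entryBox s).card = ∏ i, ∏ j, (s i j).card :=
  (Fintype.card_piFinset fun i => Fintype.piFinset (s i)).trans
    (Finset.prod_congr rfl fun _ _ => Fintype.card_piFinset _)

/-- The set `boundedMatrices n H` as a finset. -/
noncomputable def matrixBox (n H : ℕ) : Finset (Matrix (Fin n) (Fin n) ℤ) :=
  entryBox fun _ _ => Finset.Icc (-(H : ℤ)) H

theorem mem_matrixBox {n H : ℕ} {A : Matrix (Fin n) (Fin n) ℤ} :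
    A ∈ matrixBox n H ↔ A ∈ boundedMatrices n H := by
  simp only [matrixBox, boundedMatrices, Set.mem_ofPred_eq, abs_le, mem_entryBox, Finset.mem_Icc]

theorem card_matrixBox (n H : ℕ) : (matrixBox n H).card = (2 * H + 1) ^ (n ^ 2) := by
  rw [matrixBox, card_entryBox]
  simp only [Int.card_Icc, Finset.prod_const, Finset.card_univ, Fintype.card_fin]
  rw [← pow_mul, ← sq]
  congr 1
  omega

theorem abs_card_residue_sub_le (H d : ℕ) (hd : 1 ≤ d) (a : ZMod d) :
    |(((Finset.Icc (-(H : ℤ)) H).filter fun x : ℤ => (x : ZMod d) = a).card : ℝ) -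
      (2 * H + 1 : ℝ) / d| ≤ 1 := by
  have : NeZero d := ⟨by omega⟩
  have hd0 : (0 : ℚ) < d := by exact_mod_cast hd
  set v : ℤ := (a.cast : ℤ) with hv
  have hset : ((Finset.Icc (-(H : ℤ)) H).filter fun x : ℤ => (x : ZMod d) = a) =
      (Finset.Ioc (-(H : ℤ) - 1) H).filter fun x => x ≡ v [ZMOD d] := by
    ext x
    simp only [Finset.mem_filter, Finset.mem_Icc, Finset.mem_Ioc]
    rw [← ZMod.intCast_eq_intCast_iff, hv, ZMod.intCast_zmod_cast]
    constructor <;> rintro ⟨⟨h1, h2⟩, h3⟩ <;> exact ⟨⟨by omega, by omega⟩, h3⟩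
  have hc := Int.Ioc_filter_modEq_card (-(H : ℤ) - 1) H (r := (d : ℤ)) (by omega) v
  rw [hset]
  set c := ((Finset.Ioc (-(H : ℤ) - 1) H).filter fun x => x ≡ v [ZMOD d]).card
  set X : ℚ := (((H : ℤ) : ℚ) - v) / ((d : ℤ) : ℚ)
  set Y : ℚ := ((((-(H : ℤ) - 1 : ℤ)) : ℚ) - v) / ((d : ℤ) : ℚ)
  have hXY : X - Y = (2 * H + 1) / d := by
    simp only [X, Y]; push_cast; field_simp; ring
  have hXYnn : Y ≤ X := by
    have : (0 : ℚ) ≤ X - Y := by rw [hXY]; positivity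
    linarith
  rw [max_eq_left (sub_nonneg.mpr (Int.floor_le_floor hXYnn))] at hc
  have hc' : (c : ℚ) = ⌊X⌋ - ⌊Y⌋ := by exact_mod_cast hc
  have hq : |(c : ℚ) - (2 * H + 1) / d| ≤ 1 := by
    rw [hc', ← hXY, abs_le]
    have := Int.floor_le X
    have := Int.lt_floor_add_one X
    have := Int.floor_le Y
    have := Int.lt_floor_add_one Y
    constructor <;> linarith
  have := (Rat.cast_le (K := ℝ)).mpr hq
  push_cast at this
  exact this

theorem one_add_pow_le_one_add_two_pow_mul (k : ℕ) {x : ℝ} (h0 : 0 ≤ x) (h1 : x ≤ 1) :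
    (1 + x) ^ k ≤ 1 + 2 ^ k * x := by
  have h : (1 + x) ^ k ≤ 1 + (2 ^ k - 1) * x := by
    induction k with
    | zero => simp
    | succ k ih =>
      have h2 : (1 : ℝ) ≤ 2 ^ k := one_le_pow₀ (by norm_num)
      have : (1 + x) ^ k * (1 + x) ≤ (1 + (2 ^ k - 1) * x) * (1 + x) := by gcongr
      rw [pow_succ, pow_succ]
      nlinarith [mul_nonneg (mul_nonneg (sub_nonneg.mpr h2) h0) (sub_nonneg.mpr h1)]
  nlinarith

theorem one_sub_two_pow_mul_le (k : ℕ) {x : ℝ} (h0 : 0 ≤ x) (h1 : x ≤ 1) :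
    1 - 2 ^ k * x ≤ (1 - x) ^ k := by
  have h := one_add_mul_le_pow (a := -x) (by linarith) k
  have h2 : (k : ℝ) ≤ 2 ^ k := by exact_mod_cast (Nat.lt_two_pow_self (n := k)).le
  have : (1 + -x) ^ k = (1 - x) ^ k := by ring
  nlinarith

/-- As long as `d` does not exceed the side of the box, the determinant is divisible by `d` for
about the expected proportion of the matrices in the box. -/
theorem abs_card_det_dvd_sub_le (n H d : ℕ) (hd : 1 ≤ d) (hdH : d ≤ 2 * H + 1) :
    |(((matrixBox n H).filter fun A => (d : ℤ) ∣ A.det).card : ℝ) -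
        (matrixBox n H).card * singularDensity n d| ≤
      (2 ^ (n ^ 2) * d / (2 * H + 1)) * ((matrixBox n H).card * singularDensity n d) := by
  classical
  have : NeZero d := ⟨by omega⟩
  have hd0 : (0 : ℝ) < d := by exact_mod_cast hd
  set M : ℝ := 2 * H + 1 with hM
  have hM0 : 0 < M := by positivity
  have hdM : (d : ℝ) ≤ M := by rw [hM]; exact_mod_cast hdH
  let c : ZMod d → ℕ := fun a =>
    ((Finset.Icc (-(H : ℤ)) H).filter fun x : ℤ => (x : ZMod d) = a).card
  let Z : Finset (Matrix (Fin n) (Fin n) (ZMod d)) := Finset.univ.filter fun B => B.det = 0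
  have hZ : (Z.card : ℝ) = singularDensity n d * (d : ℝ) ^ (n ^ 2) := by
    unfold singularDensity
    rw [div_mul_cancel₀ _ (pow_ne_zero _ hd0.ne'), Nat.card_eq_fintype_card,
      Fintype.card_subtype]
  have hcount : ((matrixBox n H).filter fun A => (d : ℤ) ∣ A.det).card =
      ∑ B ∈ Z, ∏ i, ∏ j, c (B i j) := by
    rw [Finset.card_eq_sum_card_fiberwise
      (f := fun A : Matrix (Fin n) (Fin n) ℤ => A.map fun x => (x : ZMod d)) (t := Z)]
    · refine Finset.sum_congr rfl fun B hB => ?_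
      have hBdet : B.det = 0 := (Finset.mem_filter.mp hB).2
      have : (((matrixBox n H).filter fun A => (d : ℤ) ∣ A.det).filter
          fun A : Matrix (Fin n) (Fin n) ℤ => (A.map fun x => (x : ZMod d)) = B) =
          entryBox fun i j =>
            (Finset.Icc (-(H : ℤ)) H).filter fun x : ℤ => (x : ZMod d) = B i j := by
        ext A
        simp only [Finset.mem_filter, matrixBox, mem_entryBox]
        constructor
        · rintro ⟨⟨h1, _⟩, h3⟩ i j
          exact ⟨h1 i j, congrFun (congrFun h3 i) j⟩
        · intro h
          have h3 : (A.map fun x => (x : ZMod d)) = B := by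
            ext i j
            exact (h i j).2
          refine ⟨⟨fun i j => (h i j).1, ?_⟩, h3⟩
          rw [← ZMod.intCast_zmod_eq_zero_iff_dvd, Int.cast_det, h3, hBdet]
      rw [this, card_entryBox]
    · intro A hA
      have := (Finset.mem_filter.mp (Finset.mem_coe.mp hA)).2
      rw [← ZMod.intCast_zmod_eq_zero_iff_dvd, Int.cast_det] at this
      exact Finset.mem_coe.mpr (Finset.mem_filter.mpr ⟨Finset.mem_univ _, this⟩)
  have hcard : ((matrixBox n H).card : ℝ) = M ^ (n ^ 2) := by
    rw [card_matrixBox]; push_cast; rfl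
  have hpow : ∀ x : ℝ, x ^ (n ^ 2) = ∏ _i : Fin n, ∏ _j : Fin n, x := by
    intro x; simp [← pow_mul, sq]
  have hx0 : 0 ≤ (d : ℝ) / M := by positivity
  have hx1 : (d : ℝ) / M ≤ 1 := (div_le_one hM0).mpr hdM
  have hup : ∀ B : Matrix (Fin n) (Fin n) (ZMod d),
      ∏ i, ∏ j, (c (B i j) : ℝ) ≤ (M / d * (1 + d / M)) ^ (n ^ 2) := by
    intro B
    rw [hpow]
    refine Finset.prod_le_prod (fun i _ => Finset.prod_nonneg fun j _ => by positivity)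
      fun i _ => Finset.prod_le_prod (fun j _ => by positivity) fun j _ => ?_
    have := abs_le.mp (abs_card_residue_sub_le H d hd (B i j))
    have e : M / d * (1 + d / M) = M / d + 1 := by field_simp
    rw [e]
    linarith [this.2]
  have hlow : ∀ B : Matrix (Fin n) (Fin n) (ZMod d),
      (M / d * (1 - d / M)) ^ (n ^ 2) ≤ ∏ i, ∏ j, (c (B i j) : ℝ) := by
    intro B
    have h0 : 0 ≤ M / d * (1 - d / M) := mul_nonneg (by positivity) (by linarith)
    rw [hpow]
    refine Finset.prod_le_prod (fun i _ => Finset.prod_nonneg fun j _ => h0)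
      fun i _ => Finset.prod_le_prod (fun j _ => h0) fun j _ => ?_
    have := abs_le.mp (abs_card_residue_sub_le H d hd (B i j))
    have e : M / d * (1 - d / M) = M / d - 1 := by field_simp
    rw [e]
    linarith [this.1]
  have hδ := singularDensity_nonneg n d
  set δ := singularDensity n d
  have hmain : (Z.card : ℝ) * (M / d) ^ (n ^ 2) = M ^ (n ^ 2) * δ := by
    rw [hZ, div_pow]; field_simp
  have hnn : 0 ≤ M ^ (n ^ 2) * δ := by positivity
  have hU : ((∑ B ∈ Z, ∏ i, ∏ j, c (B i j) : ℕ) : ℝ) ≤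
      M ^ (n ^ 2) * δ * (1 + 2 ^ (n ^ 2) * (d / M)) := by
    push_cast
    calc ∑ B ∈ Z, ∏ i, ∏ j, (c (B i j) : ℝ)
        ≤ ∑ B ∈ Z, (M / d * (1 + d / M)) ^ (n ^ 2) := Finset.sum_le_sum fun B _ => hup B
      _ = (Z.card : ℝ) * (M / d) ^ (n ^ 2) * (1 + d / M) ^ (n ^ 2) := by
          rw [Finset.sum_const, nsmul_eq_mul, mul_pow]; ring
      _ ≤ _ := by
          rw [hmain]
          exact mul_le_mul_of_nonneg_left (one_add_pow_le_one_add_two_pow_mul _ hx0 hx1) hnn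
  have hLo : M ^ (n ^ 2) * δ * (1 - 2 ^ (n ^ 2) * (d / M)) ≤
      ((∑ B ∈ Z, ∏ i, ∏ j, c (B i j) : ℕ) : ℝ) := by
    push_cast
    calc M ^ (n ^ 2) * δ * (1 - 2 ^ (n ^ 2) * (d / M))
        ≤ (Z.card : ℝ) * (M / d) ^ (n ^ 2) * (1 - d / M) ^ (n ^ 2) := by
          rw [hmain]
          exact mul_le_mul_of_nonneg_left (one_sub_two_pow_mul_le _ hx0 hx1) hnn
      _ = ∑ B ∈ Z, (M / d * (1 - d / M)) ^ (n ^ 2) := by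
          rw [Finset.sum_const, nsmul_eq_mul, mul_pow]; ring
      _ ≤ _ := Finset.sum_le_sum fun B _ => hlow B
  rw [hcount, hcard, abs_le]
  have e : 2 ^ (n ^ 2) * (d : ℝ) / M = 2 ^ (n ^ 2) * (d / M) := by ring
  rw [e]
  constructor <;> nlinarith

/-! ### Truncated binomial moments of the number of prime divisors -/

/-- The expansion of `(1 + s) ^ #S` over the subsets of `S`, truncated to subsets with fewer than
`J` elements. -/
noncomputable def truncatedBinomial (s : ℝ) (J : ℕ) (S : Finset ℕ) : ℝ :=
  ∑ D ∈ S.powerset.filter fun D => D.card < J, s ^ D.card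

theorem truncatedBinomial_insert (s : ℝ) (J : ℕ) {S : Finset ℕ} {p : ℕ} (hp : p ∉ S) :
    truncatedBinomial s (J + 1) (insert p S) =
      truncatedBinomial s (J + 1) S + s * truncatedBinomial s J S := by
  have hdisj : Disjoint S.powerset (S.powerset.image (insert p)) := by
    rw [Finset.disjoint_left]
    intro D hD hD'
    obtain ⟨E, _, rfl⟩ := Finset.mem_image.mp hD'
    exact hp (Finset.mem_powerset.mp hD (Finset.mem_insert_self p E))
  have hnot : ∀ D ∈ S.powerset, p ∉ D := fun D hD h => hp (Finset.mem_powerset.mp hD h)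
  unfold truncatedBinomial
  simp only [Finset.sum_filter]
  rw [Finset.powerset_insert, Finset.sum_union hdisj, Finset.sum_image]
  · congr 1
    rw [Finset.mul_sum]
    refine Finset.sum_congr rfl fun D hD => ?_
    rw [Finset.card_insert_of_notMem (hnot D hD)]
    simp only [Nat.add_lt_add_iff_right, mul_ite, mul_zero, pow_succ']
  · intro D hD E hE h
    have := congrArg (fun X => X.erase p) h
    simpa [Finset.erase_insert (hnot D hD), Finset.erase_insert (hnot E hE)] using this

/-- The Bonferroni inequalities. -/
theorem bonferroni {t : ℝ} (h0 : 0 ≤ t) (h1 : t ≤ 1) (S : Finset ℕ) (J : ℕ) :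
    (Even J → truncatedBinomial (-t) J S ≤ (1 - t) ^ S.card) ∧
      (Odd J → (1 - t) ^ S.card ≤ truncatedBinomial (-t) J S) := by
  induction S using Finset.induction_on generalizing J with
  | empty =>
    rcases Nat.eq_zero_or_pos J with rfl | hJ
    · simp [truncatedBinomial]
    · have : truncatedBinomial (-t) J ∅ = 1 := by
        simp [truncatedBinomial, Finset.filter_singleton, hJ]
      simp [this]
  | insert p S hp ih =>
    rw [Finset.card_insert_of_notMem hp]
    rcases J with _ | J
    · refine ⟨fun _ => ?_, fun h => by simp at h⟩
      simp only [truncatedBinomial, Nat.not_lt_zero, Finset.filter_false, Finset.sum_empty]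
      exact pow_nonneg (by linarith) _
    · rw [truncatedBinomial_insert _ _ hp, pow_succ]
      constructor
      · intro hJ
        have hJ' : Odd J := by
          rcases Nat.even_or_odd J with h | h
          · exact absurd hJ (Nat.not_even_iff_odd.mpr h.add_one)
          · exact h
        have := (ih (J + 1)).1 hJ
        nlinarith [(ih J).2 hJ']
      · intro hJ
        have hJ' : Even J := by
          rcases Nat.even_or_odd J with h | h
          · exact h
          · exact absurd h.add_one (Nat.not_even_iff_odd.mpr hJ)
        have := (ih (J + 1)).2 hJ
        nlinarith [(ih J).1 hJ']

theorem one_add_pow_le_truncatedBinomial {s : ℝ} (hs : 0 ≤ s) {J K : ℕ} (hK : K < J)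
    {S : Finset ℕ} (hS : K ≤ S.card) : (1 + s) ^ K ≤ truncatedBinomial s J S := by
  obtain ⟨R, hRS, hR⟩ := Finset.exists_subset_card_eq hS
  calc (1 + s) ^ K = ∑ D ∈ R.powerset, s ^ D.card := by
        have := Finset.prod_one_add (f := fun _ : ℕ => s) R
        simp only [Finset.prod_const] at this
        rw [← this, hR]
    _ ≤ truncatedBinomial s J S := by
        apply Finset.sum_le_sum_of_subset_of_nonneg
        · intro D hD
          have hDR := Finset.mem_powerset.mp hD
          exact Finset.mem_filter.mpr ⟨Finset.mem_powerset.mpr (hDR.trans hRS),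
            lt_of_le_of_lt (hR ▸ Finset.card_le_card hDR) hK⟩
        · intro D _ _
          positivity

theorem sum_truncatedBinomial {α : Type*} (𝒜 : Finset α) (Pr : Finset ℕ) (S : α → Finset ℕ)
    (hS : ∀ x, S x ⊆ Pr) (s : ℝ) (J : ℕ) :
    ∑ x ∈ 𝒜, truncatedBinomial s J (S x) =
      ∑ D ∈ Pr.powerset.filter fun D => D.card < J,
        s ^ D.card * ((𝒜.filter fun x => D ⊆ S x).card : ℝ) := by
  have h1 : ∀ x, truncatedBinomial s J (S x) =
      ∑ D ∈ Pr.powerset.filter fun D => D.card < J, if D ⊆ S x then s ^ D.card else 0 := by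
    intro x
    rw [← Finset.sum_filter, truncatedBinomial]
    refine Finset.sum_congr ?_ fun _ _ => rfl
    ext D
    simp only [Finset.mem_filter, Finset.mem_powerset]
    exact ⟨fun h => ⟨⟨h.1.trans (hS x), h.2⟩, h.1⟩, fun h => ⟨h.2, h.1.2⟩⟩
  simp only [h1]
  rw [Finset.sum_comm]
  refine Finset.sum_congr rfl fun D _ => ?_
  rw [← Finset.sum_filter, Finset.sum_const, nsmul_eq_mul, mul_comm]

theorem sum_powerset_pow_mul_prod_le (Pr : Finset ℕ) (δ : ℕ → ℝ) (hδ : ∀ p ∈ Pr, 0 ≤ δ p) {s : ℝ}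
    (hs : 0 ≤ s) :
    ∑ D ∈ Pr.powerset, s ^ D.card * ∏ p ∈ D, δ p ≤ Real.exp (s * ∑ p ∈ Pr, δ p) := by
  have h := Finset.prod_one_add (f := fun p => s * δ p) Pr
  simp only [Finset.prod_mul_distrib, Finset.prod_const] at h
  rw [← h, Finset.mul_sum, Real.exp_sum]
  refine Finset.prod_le_prod (fun p hp => ?_) fun p _ => ?_
  · have := mul_nonneg hs (hδ p hp); linarith
  · linarith [Real.add_one_le_exp (s * δ p)]

/-- The sets `S x ⊆ Pr` behave, as far as inclusions `D ⊆ S x` with `#D < J` are concerned, like a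
random subset of `Pr` that contains the elements `p` independently with probability `δ p`, up to a
relative error `κ`. -/
def NearlyIndependent {α : Type*} (𝒜 : Finset α) (Pr : Finset ℕ) (S : α → Finset ℕ) (δ : ℕ → ℝ)
    (J : ℕ) (κ : ℝ) : Prop :=
  (∀ x, S x ⊆ Pr) ∧ (∀ p ∈ Pr, 0 ≤ δ p ∧ δ p ≤ 1) ∧ 0 ≤ κ ∧
    ∀ D ⊆ Pr, D.card < J →
      |((𝒜.filter fun x => D ⊆ S x).card : ℝ) - 𝒜.card * ∏ p ∈ D, δ p| ≤
        κ * (𝒜.card * ∏ p ∈ D, δ p)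

/-- Large values of `#(S x)` are rare. -/
theorem NearlyIndependent.card_large_mul_pow_le {α : Type*} {𝒜 : Finset α} {Pr : Finset ℕ}
    {S : α → Finset ℕ} {δ : ℕ → ℝ} {J : ℕ} {κ : ℝ} (h : NearlyIndependent 𝒜 Pr S δ J κ) {K : ℕ}
    (hK : K < J) {z : ℝ} (hz : 1 ≤ z) :
    ((𝒜.filter fun x => K ≤ (S x).card).card : ℝ) * z ^ K ≤
      𝒜.card * ((1 + κ) * Real.exp ((z - 1) * ∑ p ∈ Pr, δ p)) := by
  obtain ⟨hS, hδ, hκ, hE⟩ := h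
  have hz0 : 0 ≤ z - 1 := by linarith
  have hprod : ∀ D ⊆ Pr, 0 ≤ ∏ p ∈ D, δ p := fun D hD =>
    Finset.prod_nonneg fun p hp => (hδ p (hD hp)).1
  have htrunc : ∀ x, 0 ≤ truncatedBinomial (z - 1) J (S x) := fun x =>
    Finset.sum_nonneg fun D _ => by positivity
  calc ((𝒜.filter fun x => K ≤ (S x).card).card : ℝ) * z ^ K
      = ∑ x ∈ 𝒜.filter (fun x => K ≤ (S x).card), z ^ K := by
        rw [Finset.sum_const, nsmul_eq_mul]
    _ ≤ ∑ x ∈ 𝒜.filter (fun x => K ≤ (S x).card), truncatedBinomial (z - 1) J (S x) := by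
        refine Finset.sum_le_sum fun x hx => ?_
        have := one_add_pow_le_truncatedBinomial hz0 hK (Finset.mem_filter.mp hx).2
        rwa [add_sub_cancel] at this
    _ ≤ ∑ x ∈ 𝒜, truncatedBinomial (z - 1) J (S x) :=
        Finset.sum_le_sum_of_subset_of_nonneg (Finset.filter_subset _ _) fun x _ _ => htrunc x
    _ = ∑ D ∈ Pr.powerset.filter fun D => D.card < J,
          (z - 1) ^ D.card * ((𝒜.filter fun x => D ⊆ S x).card : ℝ) :=
        sum_truncatedBinomial 𝒜 Pr S hS _ J
    _ ≤ ∑ D ∈ Pr.powerset.filter fun D => D.card < J,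
          (z - 1) ^ D.card * ((1 + κ) * (𝒜.card * ∏ p ∈ D, δ p)) := by
        refine Finset.sum_le_sum fun D hD => ?_
        obtain ⟨hD1, hD2⟩ := Finset.mem_filter.mp hD
        have := (abs_le.mp (hE D (Finset.mem_powerset.mp hD1) hD2)).2
        exact mul_le_mul_of_nonneg_left (by linarith) (by positivity)
    _ ≤ ∑ D ∈ Pr.powerset, (z - 1) ^ D.card * ((1 + κ) * (𝒜.card * ∏ p ∈ D, δ p)) :=
        Finset.sum_le_sum_of_subset_of_nonneg (Finset.filter_subset _ _) fun D hD _ => by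
          have := hprod D (Finset.mem_powerset.mp hD)
          positivity
    _ = 𝒜.card * ((1 + κ) * ∑ D ∈ Pr.powerset, (z - 1) ^ D.card * ∏ p ∈ D, δ p) := by
        rw [Finset.mul_sum, Finset.mul_sum]
        exact Finset.sum_congr rfl fun D _ => by ring
    _ ≤ _ := by
        have := sum_powerset_pow_mul_prod_le Pr δ (fun p hp => (hδ p hp).1) hz0
        gcongr

/-- The moments `∑ (1 - t) ^ #(S x)` are bounded by those of the independent model. The errors
come from truncating the inclusion-exclusion at `J` and from `κ`. -/
theorem NearlyIndependent.sum_pow_card_le {α : Type*} {𝒜 : Finset α} {Pr : Finset ℕ}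
    {S : α → Finset ℕ} {δ : ℕ → ℝ} {J : ℕ} {κ : ℝ} (h : NearlyIndependent 𝒜 Pr S δ J κ)
    (hJ : Odd J) {t : ℝ} (ht0 : 0 ≤ t) (ht1 : t ≤ 1) :
    ∑ x ∈ 𝒜, (1 - t) ^ (S x).card ≤
      𝒜.card * (Real.exp (-(t * ∑ p ∈ Pr, δ p)) + Real.exp (Real.exp 1 * ∑ p ∈ Pr, δ p - J) +
        κ * Real.exp (∑ p ∈ Pr, δ p)) := by
  obtain ⟨hS, hδ, hκ, hE⟩ := h
  have hprod : ∀ D ⊆ Pr, 0 ≤ ∏ p ∈ D, δ p := fun D hD =>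
    Finset.prod_nonneg fun p hp => (hδ p (hD hp)).1
  have htpow : ∀ k : ℕ, |(-t) ^ k| ≤ 1 := fun k => by
    rw [abs_pow, abs_neg, abs_of_nonneg ht0]
    exact pow_le_one₀ ht0 ht1
  set P : Finset ℕ → ℝ := fun D => ∏ p ∈ D, δ p with hP
  have hfull : ∑ D ∈ Pr.powerset, (-t) ^ D.card * P D ≤ Real.exp (-(t * ∑ p ∈ Pr, δ p)) := by
    have h := Finset.prod_one_add (f := fun p => (-t) * δ p) Pr
    simp only [Finset.prod_mul_distrib, Finset.prod_const] at h
    rw [hP, ← h, Finset.mul_sum, ← Finset.sum_neg_distrib, Real.exp_sum]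
    refine Finset.prod_le_prod (fun p hp => ?_) fun p _ => ?_
    · have := mul_le_one₀ ht1 (hδ p hp).1 (hδ p hp).2; linarith
    · linarith [Real.add_one_le_exp (-(t * δ p))]
  have htail : ∑ D ∈ Pr.powerset.filter (fun D => ¬ D.card < J), P D ≤
      Real.exp (Real.exp 1 * ∑ p ∈ Pr, δ p - J) := by
    have h1 : ∑ D ∈ Pr.powerset.filter (fun D => ¬ D.card < J), P D ≤
        ∑ D ∈ Pr.powerset, Real.exp (-J) * (Real.exp 1 ^ D.card * P D) := by
      refine (Finset.sum_le_sum fun D hD => ?_).trans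
        (Finset.sum_le_sum_of_subset_of_nonneg (Finset.filter_subset _ _) fun D hD _ => ?_)
      · obtain ⟨hD1, hD2⟩ := Finset.mem_filter.mp hD
        have hJD : (J : ℝ) ≤ D.card := by exact_mod_cast not_lt.mp hD2
        have h0 := hprod D (Finset.mem_powerset.mp hD1)
        have : 1 ≤ Real.exp (-J) * Real.exp 1 ^ D.card := by
          rw [← Real.exp_nat_mul, ← Real.exp_add, mul_one]
          exact Real.one_le_exp (by linarith)
        calc P D ≤ (Real.exp (-J) * Real.exp 1 ^ D.card) * P D := le_mul_of_one_le_left h0 this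
          _ = _ := by ring
      · have := hprod D (Finset.mem_powerset.mp hD)
        positivity
    rw [← Finset.mul_sum] at h1
    refine h1.trans ?_
    rw [sub_eq_neg_add, Real.exp_add]
    exact mul_le_mul_of_nonneg_left
      (sum_powerset_pow_mul_prod_le Pr δ (fun p hp => (hδ p hp).1) (Real.exp_pos 1).le)
      (Real.exp_pos _).le
  have hsum : ∑ D ∈ Pr.powerset.filter (fun D => D.card < J), P D ≤
      Real.exp (∑ p ∈ Pr, δ p) := by
    have := sum_powerset_pow_mul_prod_le Pr δ (fun p hp => (hδ p hp).1) zero_le_one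
    simp only [one_pow, one_mul] at this
    exact (Finset.sum_le_sum_of_subset_of_nonneg (Finset.filter_subset _ _)
      fun D hD _ => hprod D (Finset.mem_powerset.mp hD)).trans this
  have hsplit : ∑ D ∈ Pr.powerset.filter (fun D => D.card < J), (-t) ^ D.card * P D ≤
      ∑ D ∈ Pr.powerset, (-t) ^ D.card * P D +
        ∑ D ∈ Pr.powerset.filter (fun D => ¬ D.card < J), P D := by
    rw [← Finset.sum_filter_add_sum_filter_not Pr.powerset (fun D => D.card < J)
      (fun D => (-t) ^ D.card * P D), add_assoc, ← Finset.sum_add_distrib]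
    refine le_add_of_nonneg_right (Finset.sum_nonneg fun D hD => ?_)
    have h0 := hprod D (Finset.mem_powerset.mp (Finset.mem_filter.mp hD).1)
    have := (abs_le.mp (htpow D.card)).1
    nlinarith
  calc ∑ x ∈ 𝒜, (1 - t) ^ (S x).card
      ≤ ∑ x ∈ 𝒜, truncatedBinomial (-t) J (S x) :=
        Finset.sum_le_sum fun x _ => (bonferroni ht0 ht1 (S x) J).2 hJ
    _ = ∑ D ∈ Pr.powerset.filter fun D => D.card < J,
          (-t) ^ D.card * ((𝒜.filter fun x => D ⊆ S x).card : ℝ) :=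
        sum_truncatedBinomial 𝒜 Pr S hS _ J
    _ ≤ ∑ D ∈ Pr.powerset.filter fun D => D.card < J,
          (𝒜.card * ((-t) ^ D.card * P D) + 𝒜.card * (κ * P D)) := by
        refine Finset.sum_le_sum fun D hD => ?_
        obtain ⟨hD1, hD2⟩ := Finset.mem_filter.mp hD
        have hE' := hE D (Finset.mem_powerset.mp hD1) hD2
        set N : ℝ := ((𝒜.filter fun x => D ⊆ S x).card : ℝ)
        have h1 : (-t) ^ D.card * (N - 𝒜.card * P D) ≤ κ * (𝒜.card * P D) := by
          refine (le_abs_self _).trans ?_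
          rw [abs_mul]
          exact (mul_le_of_le_one_left (abs_nonneg _) (htpow _)).trans hE'
        linarith
    _ = 𝒜.card * (∑ D ∈ Pr.powerset.filter (fun D => D.card < J), (-t) ^ D.card * P D +
          κ * ∑ D ∈ Pr.powerset.filter (fun D => D.card < J), P D) := by
        rw [Finset.sum_add_distrib, ← Finset.mul_sum, ← Finset.mul_sum, ← Finset.mul_sum]
        ring
    _ ≤ _ := by
        have := mul_le_mul_of_nonneg_left hsum hκ
        refine mul_le_mul_of_nonneg_left ?_ (Nat.cast_nonneg _)
        linarith

/-! ### Splitting the product set according to the prime divisors of determinants -/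

/-- The primes of `Pr` that divide the determinant of `A`. -/
def detPrimes {n : ℕ} (Pr : Finset ℕ) (A : Matrix (Fin n) (Fin n) ℤ) : Finset ℕ :=
  Pr.filter fun p => (p : ℤ) ∣ A.det

theorem subset_detPrimes_iff {n : ℕ} {Pr D : Finset ℕ} (hPr : ∀ p ∈ Pr, p.Prime) (hD : D ⊆ Pr)
    (A : Matrix (Fin n) (Fin n) ℤ) :
    D ⊆ detPrimes Pr A ↔ ((∏ p ∈ D, p : ℕ) : ℤ) ∣ A.det := by
  constructor
  · intro h
    rw [Int.natCast_dvd]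
    refine Finset.prod_primes_dvd _ (fun p hp => (hPr p (hD hp)).prime) fun p hp => ?_
    rw [← Int.natCast_dvd]
    exact (Finset.mem_filter.mp (h hp)).2
  · intro h p hp
    refine Finset.mem_filter.mpr ⟨hD hp, dvd_trans ?_ h⟩
    exact_mod_cast Finset.dvd_prod_of_mem (fun p => p) hp

theorem nearlyIndependent_matrixBox {n H J : ℕ} {Pr : Finset ℕ} (hPr : ∀ p ∈ Pr, p.Prime) {R : ℝ}
    (hR0 : 0 ≤ R) (hR : ∀ D ⊆ Pr, D.card < J → ((∏ p ∈ D, p : ℕ) : ℝ) ≤ R)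
    (hRH : R ≤ 2 * H + 1) :
    NearlyIndependent (matrixBox n H) Pr (detPrimes Pr) (singularDensity n) J
      (2 ^ (n ^ 2) * R / (2 * H + 1)) := by
  refine ⟨fun x => Finset.filter_subset _ _, fun p hp => ⟨singularDensity_nonneg n p, ?_⟩,
    by positivity, fun D hD hDJ => ?_⟩
  · rw [singularDensity_prime n (hPr p hp)]
    refine sub_le_self _ (Finset.prod_nonneg fun i _ => sub_nonneg.mpr (pow_le_one₀ ?_ ?_))
    · positivity
    · exact inv_le_one_of_one_le₀ (by exact_mod_cast (hPr p hp).one_le)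
  · have hd : 1 ≤ ∏ p ∈ D, p := Finset.prod_pos fun p hp => (hPr p (hD hp)).pos
    have hdR := hR D hD hDJ
    have hdH : ∏ p ∈ D, p ≤ 2 * H + 1 := by exact_mod_cast hdR.trans hRH
    have h := abs_card_det_dvd_sub_le n H _ hd hdH
    rw [singularDensity_prod n D fun p hp => hPr p (hD hp)] at h
    simp only [subset_detPrimes_iff hPr hD]
    refine h.trans ?_
    have : 0 ≤ ∏ p ∈ D, singularDensity n p :=
      Finset.prod_nonneg fun p _ => singularDensity_nonneg n p
    gcongr

theorem list_prod_mem_boundedMatrices (n H : ℕ) {k : ℕ}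
    (A : Fin (k + 1) → Matrix (Fin n) (Fin n) ℤ) (hA : ∀ i, A i ∈ boundedMatrices n H) :
    (List.ofFn A).prod ∈ boundedMatrices n (n ^ k * H ^ (k + 1)) := by
  induction k with
  | zero => simpa using hA 0
  | succ k ih =>
    rw [List.ofFn_succ, List.prod_cons]
    have ih' := ih (fun i => A i.succ) fun i => hA i.succ
    intro i j
    rw [Matrix.mul_apply]
    calc |∑ l, A 0 i l * (List.ofFn fun i => A i.succ).prod l j|
        ≤ ∑ l, |A 0 i l * (List.ofFn fun i => A i.succ).prod l j| :=
          Finset.abs_sum_le_sum_abs _ _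
      _ ≤ ∑ _l : Fin n, (H : ℤ) * ((n ^ k * H ^ (k + 1) : ℕ) : ℤ) := by
          refine Finset.sum_le_sum fun l _ => ?_
          rw [abs_mul]
          exact mul_le_mul (hA 0 i l) (ih' l j) (abs_nonneg _) (by positivity)
      _ = ((n ^ (k + 1) * H ^ (k + 1 + 1) : ℕ) : ℤ) := by
          simp; ring

theorem det_list_prod_ofFn {n m : ℕ} (A : Fin m → Matrix (Fin n) (Fin n) ℤ) :
    (List.ofFn A).prod.det = ∏ i, (A i).det := by
  have h := map_list_prod (Matrix.detMonoidHom : Matrix (Fin n) (Fin n) ℤ →* ℤ) (List.ofFn A)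
  rw [List.map_ofFn, List.prod_ofFn] at h
  exact h

/-- Unless one of the primes divides two of the determinants, the number of prime divisors of the
determinant is additive. -/
theorem sum_card_detPrimes_le {n m : ℕ} {Pr : Finset ℕ} (A : Fin m → Matrix (Fin n) (Fin n) ℤ)
    (h : ∀ p ∈ Pr, ∀ i j, i ≠ j → ¬ ((p : ℤ) ∣ (A i).det ∧ (p : ℤ) ∣ (A j).det)) :
    ∑ i, (detPrimes Pr (A i)).card ≤ (detPrimes Pr (List.ofFn A).prod).card := by
  rw [← Finset.card_biUnion]
  · refine Finset.card_le_card fun p hp => ?_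
    obtain ⟨i, _, hi⟩ := Finset.mem_biUnion.mp hp
    obtain ⟨h1, h2⟩ := Finset.mem_filter.mp hi
    refine Finset.mem_filter.mpr ⟨h1, ?_⟩
    rw [det_list_prod_ofFn]
    exact h2.trans (Finset.dvd_prod_of_mem (fun i => (A i).det) (Finset.mem_univ i))
  · intro i _ j _ hij
    refine Finset.disjoint_left.mpr fun p hp hp' => ?_
    obtain ⟨h1, h2⟩ := Finset.mem_filter.mp hp
    exact h p h1 i j hij ⟨h2, (Finset.mem_filter.mp hp').2⟩

theorem ncard_productSet_le_add {m n H : ℕ} (hm : 1 ≤ m) (Pr : Finset ℕ) (K : ℕ) :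
    (productSet m n H).ncard ≤
      ((Fintype.piFinset fun _ : Fin m => matrixBox n H).filter fun A =>
        ∃ p ∈ Pr, ∃ i j, i ≠ j ∧ (p : ℤ) ∣ (A i).det ∧ (p : ℤ) ∣ (A j).det).card +
      ((matrixBox n (n ^ (m - 1) * H ^ m)).filter fun C => K ≤ (detPrimes Pr C).card).card +
      ((Fintype.piFinset fun _ : Fin m => matrixBox n H).filter fun A =>
        ∑ i, (detPrimes Pr (A i)).card < K).card := by
  classical
  set X := (Fintype.piFinset fun _ : Fin m => matrixBox n H).filter fun A =>
        ∃ p ∈ Pr, ∃ i j, i ≠ j ∧ (p : ℤ) ∣ (A i).det ∧ (p : ℤ) ∣ (A j).det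
  set Y := (matrixBox n (n ^ (m - 1) * H ^ m)).filter fun C => K ≤ (detPrimes Pr C).card
  set Z := (Fintype.piFinset fun _ : Fin m => matrixBox n H).filter fun A =>
        ∑ i, (detPrimes Pr (A i)).card < K
  let f : (Fin m → Matrix (Fin n) (Fin n) ℤ) → Matrix (Fin n) (Fin n) ℤ :=
    fun A => (List.ofFn A).prod
  have hsub : productSet m n H ⊆ ((X.image f ∪ Y ∪ Z.image f : Finset _) : Set _) := by
    rintro C ⟨A, hA, rfl⟩
    have hA' : A ∈ Fintype.piFinset fun _ : Fin m => matrixBox n H :=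
      Fintype.mem_piFinset.mpr fun i => mem_matrixBox.mpr (hA i)
    have hC : (List.ofFn A).prod ∈ matrixBox n (n ^ (m - 1) * H ^ m) := by
      obtain ⟨k, rfl⟩ : ∃ k, m = k + 1 := ⟨m - 1, by omega⟩
      exact mem_matrixBox.mpr (list_prod_mem_boundedMatrices n H A hA)
    simp only [Finset.coe_union, Set.mem_union, Finset.mem_coe]
    by_cases h1 : ∃ p ∈ Pr, ∃ i j, i ≠ j ∧ (p : ℤ) ∣ (A i).det ∧ (p : ℤ) ∣ (A j).det
    · exact Or.inl (Or.inl (Finset.mem_image_of_mem f (Finset.mem_filter.mpr ⟨hA', h1⟩)))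
    by_cases h2 : K ≤ (detPrimes Pr (List.ofFn A).prod).card
    · exact Or.inl (Or.inr (Finset.mem_filter.mpr ⟨hC, h2⟩))
    · refine Or.inr (Finset.mem_image_of_mem f (Finset.mem_filter.mpr ⟨hA', ?_⟩))
      refine lt_of_le_of_lt (sum_card_detPrimes_le A fun p hp i j hij h3 => ?_) (not_le.mp h2)
      exact h1 ⟨p, hp, i, j, hij, h3⟩
  calc (productSet m n H).ncard
      ≤ ((X.image f ∪ Y ∪ Z.image f : Finset _) : Set (Matrix (Fin n) (Fin n) ℤ)).ncard :=
        Set.ncard_le_ncard hsub (Finset.finite_toSet _)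
    _ = (X.image f ∪ Y ∪ Z.image f).card := Set.ncard_coe_finset _
    _ ≤ (X.image f).card + Y.card + (Z.image f).card :=
        (Finset.card_union_le _ _).trans (by gcongr; exact Finset.card_union_le _ _)
    _ ≤ X.card + Y.card + Z.card := by
        gcongr <;> exact Finset.card_image_le

/-- Tuples of matrices for which one of the primes divides two of the determinants. -/
theorem card_common_prime_le {m n H : ℕ} (Pr : Finset ℕ) (η : ℕ → ℝ)
    (hη : ∀ p ∈ Pr, (((matrixBox n H).filter fun A => (p : ℤ) ∣ A.det).card : ℝ) ≤
      η p * (matrixBox n H).card) :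
    (((Fintype.piFinset fun _ : Fin m => matrixBox n H).filter fun A =>
        ∃ p ∈ Pr, ∃ i j, i ≠ j ∧ (p : ℤ) ∣ (A i).det ∧ (p : ℤ) ∣ (A j).det).card : ℝ) ≤
      m ^ 2 * ((matrixBox n H).card : ℝ) ^ m * ∑ p ∈ Pr, η p ^ 2 := by
  classical
  set Box := matrixBox n H with hBox
  let I : Finset (Fin m × Fin m) := Finset.univ.filter fun ij => ij.1 ≠ ij.2
  let F : ℕ → Fin m × Fin m → Finset (Fin m → Matrix (Fin n) (Fin n) ℤ) := fun p ij =>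
    Fintype.piFinset fun k => if k = ij.1 ∨ k = ij.2 then Box.filter fun A => (p : ℤ) ∣ A.det
      else Box
  have hsub : ((Fintype.piFinset fun _ : Fin m => Box).filter fun A =>
        ∃ p ∈ Pr, ∃ i j, i ≠ j ∧ (p : ℤ) ∣ (A i).det ∧ (p : ℤ) ∣ (A j).det) ⊆
      Pr.biUnion fun p => I.biUnion fun ij => F p ij := by
    intro A hA
    obtain ⟨hA1, p, hp, i, j, hij, h1, h2⟩ := Finset.mem_filter.mp hA
    rw [Fintype.mem_piFinset] at hA1
    refine Finset.mem_biUnion.mpr ⟨p, hp, Finset.mem_biUnion.mpr ⟨(i, j),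
      Finset.mem_filter.mpr ⟨Finset.mem_univ _, hij⟩, Fintype.mem_piFinset.mpr fun k => ?_⟩⟩
    split_ifs with hk
    · refine Finset.mem_filter.mpr ⟨hA1 k, ?_⟩
      rcases hk with rfl | rfl
      · exact h1
      · exact h2
    · exact hA1 k
  have hF : ∀ p ∈ Pr, ∀ ij ∈ I, ((F p ij).card : ℝ) ≤ (Box.card : ℝ) ^ m * η p ^ 2 := by
    rintro p hp ⟨i, j⟩ hij
    have hij' : i ≠ j := (Finset.mem_filter.mp hij).2
    have hcard : ((F p (i, j)).card : ℝ) ≤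
        ∏ k : Fin m, (Box.card : ℝ) * if k ∈ ({i, j} : Finset (Fin m)) then η p else 1 := by
      simp only [F]
      rw [Fintype.card_piFinset, Nat.cast_prod]
      refine Finset.prod_le_prod (fun k _ => by positivity) fun k _ => ?_
      simp only [Finset.mem_insert, Finset.mem_singleton]
      split_ifs
      · rw [mul_comm]; exact hη p hp
      · simp
    rw [Finset.prod_mul_distrib, Finset.prod_const, Finset.card_univ, Fintype.card_fin,
      Finset.prod_ite_mem, Finset.univ_inter, Finset.prod_const, Finset.card_pair hij'] at hcard
    exact hcard
  have hI : (I.card : ℝ) ≤ m ^ 2 := by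
    have : I.card ≤ m ^ 2 := by
      refine (Finset.card_filter_le _ _).trans (le_of_eq ?_)
      simp [sq]
    exact_mod_cast this
  calc _ ≤ ((Pr.biUnion fun p => I.biUnion fun ij => F p ij).card : ℝ) := by
        exact_mod_cast Finset.card_le_card hsub
    _ ≤ ∑ p ∈ Pr, ∑ ij ∈ I, ((F p ij).card : ℝ) := by
        have h1 : (Pr.biUnion fun p => I.biUnion fun ij => F p ij).card ≤
            ∑ p ∈ Pr, ∑ ij ∈ I, (F p ij).card :=
          Finset.card_biUnion_le.trans (Finset.sum_le_sum fun p _ => Finset.card_biUnion_le)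
        exact_mod_cast h1
    _ ≤ ∑ p ∈ Pr, ∑ _ij ∈ I, (Box.card : ℝ) ^ m * η p ^ 2 :=
        Finset.sum_le_sum fun p hp => Finset.sum_le_sum fun ij hij => hF p hp ij hij
    _ = I.card * (Box.card : ℝ) ^ m * ∑ p ∈ Pr, η p ^ 2 := by
        simp only [Finset.sum_const, nsmul_eq_mul]
        rw [Finset.mul_sum]
        exact Finset.sum_congr rfl fun p _ => by ring
    _ ≤ _ := by
        have : 0 ≤ ∑ p ∈ Pr, η p ^ 2 := Finset.sum_nonneg fun p _ => sq_nonneg _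
        gcongr

/-- Rankin's trick for tuples whose determinants have few prime divisors in total. -/
theorem card_few_primes_mul_pow_le {m n H : ℕ} (Pr : Finset ℕ) (K : ℕ) {y : ℝ} (hy0 : 0 ≤ y)
    (hy1 : y ≤ 1) :
    (((Fintype.piFinset fun _ : Fin m => matrixBox n H).filter fun A =>
        ∑ i, (detPrimes Pr (A i)).card < K).card : ℝ) * y ^ K ≤
      (∑ A ∈ matrixBox n H, y ^ (detPrimes Pr A).card) ^ m := by
  classical
  have h := Finset.sum_prod_piFinset (ι := Fin m) (matrixBox n H)
    fun _ A => y ^ (detPrimes Pr A).card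
  rw [Finset.prod_const, Finset.card_univ, Fintype.card_fin] at h
  rw [← h, ← nsmul_eq_mul, ← Finset.sum_const]
  refine (Finset.sum_le_sum fun A hA => ?_).trans
    (Finset.sum_le_sum_of_subset_of_nonneg (Finset.filter_subset _ _) fun A _ _ => ?_)
  · rw [Finset.prod_pow_eq_pow_sum]
    exact pow_le_pow_of_le_one hy0 hy1 (Finset.mem_filter.mp hA).2.le
  · exact Finset.prod_nonneg fun i _ => by positivity

/-! ### The upper bound -/

/-- In terms of `L = log log H`, the primes between `(log H) ^ a` and `exp (log H / L ^ 2)` have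
reciprocal sum close to `L`: by Mertens' theorem, cutting at these two points costs only
`O(log L)`. -/
theorem eventually_exists_primes {a ε : ℝ} (ha : 0 < a) (hε : 0 < ε) :
    ∀ᶠ L : ℝ in atTop, ∃ Pr : Finset ℕ,
      (∀ p ∈ Pr, p.Prime ∧ Real.exp (a * L) ≤ p ∧ (p : ℝ) ≤ Real.exp (Real.exp L / L ^ 2)) ∧
      (1 - ε) * L ≤ ∑ p ∈ Pr, (1 : ℝ) / p ∧ ∑ p ∈ Pr, (1 : ℝ) / p ≤ (1 + ε) * L := by
  obtain ⟨C₁, hC₁⟩ := exists_sum_inv_primesLE_le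
  obtain ⟨C₂, hC₂⟩ := exists_le_sum_inv_primesLE
  have hlog : ∀ᶠ L : ℝ in atTop, Real.log L ≤ ε / 6 * L := by
    filter_upwards [Real.isLittleO_log_id_atTop.bound (by positivity : 0 < ε / 6),
      eventually_ge_atTop 1] with L hL h1
    have := le_of_abs_le hL
    rwa [id, Real.norm_of_nonneg (by linarith)] at this
  have hexp : ∀ᶠ L : ℝ in atTop, 2 * L ^ 2 ≤ Real.exp L := by
    filter_upwards [(Real.tendsto_exp_div_pow_atTop 2).eventually_ge_atTop 2,
      eventually_gt_atTop 0] with L hL h0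
    rwa [le_div_iff₀ (by positivity)] at hL
  filter_upwards [hlog, hexp, eventually_ge_atTop 1, eventually_ge_atTop (1 / a),
    eventually_ge_atTop ((|C₁| + |C₂| + |C₁| + Real.log 2 + |Real.log a|) / (ε / 2))]
    with L hL hE h1 hLa hLC
  have hL0 : 0 < L := by linarith
  rw [div_le_iff₀ (by positivity)] at hLC
  rw [div_le_iff₀ ha] at hLa
  have hlogL : 0 ≤ Real.log L := Real.log_nonneg h1
  set v := Real.exp L / L ^ 2 with hv
  have hv2 : 2 ≤ v := by rw [hv, le_div_iff₀ (by positivity)]; exact hE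
  set w := Real.exp v with hw
  have he2 : 2 < Real.exp 1 := by linarith [Real.exp_one_gt_d9]
  have hw4 : 4 ≤ w := by
    have : Real.exp 2 ≤ w := Real.exp_le_exp.mpr hv2
    have h : Real.exp 2 = Real.exp 1 * Real.exp 1 := by rw [← Real.exp_add]; norm_num
    nlinarith
  set N := ⌊w⌋₊ with hN
  have hNw : (N : ℝ) ≤ w := Nat.floor_le (by linarith)
  have hwN : w - 1 ≤ N := by linarith [Nat.lt_floor_add_one w]
  have hN2 : 2 ≤ N := by
    have : (2 : ℝ) ≤ N := by linarith
    exact_mod_cast this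
  have hP2 : 2 ≤ Real.exp (a * L) := by
    have : Real.exp 1 ≤ Real.exp (a * L) := Real.exp_le_exp.mpr (by linarith)
    linarith
  set M := ⌊Real.exp (a * L)⌋₊ with hM
  have hMP : (M : ℝ) ≤ Real.exp (a * L) := Nat.floor_le (by positivity)
  have hM2 : 2 ≤ M := Nat.le_floor (by exact_mod_cast hP2)
  have hlogv : Real.log v = L - 2 * Real.log L := by
    rw [hv, Real.log_div (by positivity) (by positivity), Real.log_exp, Real.log_pow]
    norm_num
  have hlogN : Real.log N ≤ v := by
    have := Real.log_le_log (by positivity : (0 : ℝ) < N) hNw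
    rwa [hw, Real.log_exp] at this
  have hlogN' : v / 2 ≤ Real.log N := by
    have h2 : Real.exp (v / 2) ≤ N := by
      have hsq : Real.exp (v / 2) * Real.exp (v / 2) = w := by
        rw [← Real.exp_add, hw]; congr 1; ring
      have := Real.exp_pos (v / 2)
      nlinarith
    have := Real.log_le_log (Real.exp_pos _) h2
    rwa [Real.log_exp] at this
  have hNpos : 0 < Real.log N := by linarith
  have hup := hC₁ N hN2
  have hlo := hC₂ N hN2
  have hupM := hC₁ M hM2
  have hllN : Real.log (Real.log N) ≤ L - 2 * Real.log L := by
    rw [← hlogv]; exact Real.log_le_log hNpos hlogN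
  have hllN' : L - 2 * Real.log L - Real.log 2 ≤ Real.log (Real.log N) := by
    rw [← hlogv, ← Real.log_div (by linarith) (by norm_num)]
    exact Real.log_le_log (by linarith) hlogN'
  have hMpos : 0 < Real.log M := Real.log_pos (by exact_mod_cast (by omega : 1 < M))
  have hllM : Real.log (Real.log M) ≤ Real.log a + Real.log L := by
    rw [← Real.log_mul ha.ne' hL0.ne']
    apply Real.log_le_log hMpos
    have := Real.log_le_log (by positivity : (0 : ℝ) < M) hMP
    rwa [Real.log_exp] at this
  have habs := le_abs_self C₁
  have habs2 := le_abs_self C₂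
  have habsa := le_abs_self (Real.log a)
  have hnna := abs_nonneg (Real.log a)
  have hnn1 := abs_nonneg C₁
  have hnn2 := abs_nonneg C₂
  have hlog2 : 0 ≤ Real.log 2 := Real.log_nonneg (by norm_num)
  refine ⟨N.primesLE.filter fun p => Real.exp (a * L) ≤ p, fun p hp => ?_, ?_, ?_⟩
  · obtain ⟨h3, h4⟩ := Finset.mem_filter.mp hp
    obtain ⟨h5, h6⟩ := Nat.mem_primesLE.mp h3
    exact ⟨h6, h4, le_trans (by exact_mod_cast h5) hNw⟩
  · have hsplit := Finset.sum_filter_add_sum_filter_not N.primesLE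
      (fun p : ℕ => Real.exp (a * L) ≤ p) (fun p => (1 : ℝ) / p)
    have hsmall : ∑ p ∈ N.primesLE.filter (fun p : ℕ => ¬ Real.exp (a * L) ≤ p), (1 : ℝ) / p ≤
        ∑ p ∈ M.primesLE, (1 : ℝ) / p := by
      apply Finset.sum_le_sum_of_subset_of_nonneg
      · intro p hp
        obtain ⟨h3, h4⟩ := Finset.mem_filter.mp hp
        exact Nat.mem_primesLE.mpr ⟨Nat.le_floor (not_le.mp h4).le, (Nat.mem_primesLE.mp h3).2⟩
      · intro p _ _
        positivity
    nlinarith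
  · have : ∑ p ∈ N.primesLE.filter (fun p : ℕ => Real.exp (a * L) ≤ p), (1 : ℝ) / p ≤
        ∑ p ∈ N.primesLE, (1 : ℝ) / p :=
      Finset.sum_le_sum_of_subset_of_nonneg (Finset.filter_subset _ _) fun p _ _ => by positivity
    nlinarith

/-- The contribution of the tuples in which a prime divides two of the determinants. -/
theorem card_common_prime_le_sum_inv_sq {m n H J : ℕ} {Pr : Finset ℕ} {κ : ℝ}
    (hprime : ∀ p ∈ Pr, p.Prime) (hJ : 1 < J) (hκ : κ ≤ 1)
    (hI : NearlyIndependent (matrixBox n H) Pr (detPrimes Pr) (singularDensity n) J κ) :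
    (((Fintype.piFinset fun _ : Fin m => matrixBox n H).filter fun A =>
        ∃ p ∈ Pr, ∃ i j, i ≠ j ∧ (p : ℤ) ∣ (A i).det ∧ (p : ℤ) ∣ (A j).det).card : ℝ) ≤
      16 * m ^ 2 * ((matrixBox n H).card : ℝ) ^ m * ∑ p ∈ Pr, (1 : ℝ) / p ^ 2 := by
  have h1 := card_common_prime_le (m := m) (n := n) (H := H) Pr (fun p => 4 / p)
    (fun p hp => by
      have h2 := hI.2.2.2 {p} (Finset.singleton_subset_iff.mpr hp) (by
        rwa [Finset.card_singleton])
      have h3 : ∀ A : Matrix (Fin n) (Fin n) ℤ, {p} ⊆ detPrimes Pr A ↔ (p : ℤ) ∣ A.det := by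
        intro A
        rw [subset_detPrimes_iff hprime (Finset.singleton_subset_iff.mpr hp),
          Finset.prod_singleton]
      simp only [h3, Finset.prod_singleton] at h2
      have h4 := (abs_le.mp h2).2
      have h5 := singularDensity_prime_le (n := n) (hprime p hp)
      have h6 : (2 : ℝ) ≤ p := by exact_mod_cast (hprime p hp).two_le
      have h7 : 2 / (p : ℝ) ^ 2 ≤ 1 / p := by
        rw [div_le_div_iff₀ (by positivity) (by positivity)]; nlinarith
      have h8 : 0 ≤ ((matrixBox n H).card : ℝ) * singularDensity n p :=
        mul_nonneg (Nat.cast_nonneg _) (singularDensity_nonneg n p)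
      have h9 := mul_le_mul_of_nonneg_right hκ h8
      have h10 : singularDensity n p ≤ 2 / p := by
        have : (2 : ℝ) / p = 1 / p + 1 / p := by ring
        linarith
      have h11 := mul_le_mul_of_nonneg_left h10 (Nat.cast_nonneg (α := ℝ) (matrixBox n H).card)
      have h12 : (4 : ℝ) / p * (matrixBox n H).card = 2 * ((matrixBox n H).card * (2 / p)) := by
        ring
      rw [h12]
      linarith)
  refine h1.trans (le_of_eq ?_)
  have e : ∑ p ∈ Pr, ((4 : ℝ) / p) ^ 2 = 16 * ∑ p ∈ Pr, (1 : ℝ) / p ^ 2 := by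
    rw [Finset.mul_sum]
    exact Finset.sum_congr rfl fun p _ => by ring
  rw [e]
  ring

/-- The large deviations of the number of prime divisors, for `K` close to `u L`. -/
theorem NearlyIndependent.card_large_le {α : Type*} {𝒜 : Finset α} {Pr : Finset ℕ}
    {S : α → Finset ℕ} {δ : ℕ → ℝ} {J K : ℕ} {κ u L ε M : ℝ}
    (hI : NearlyIndependent 𝒜 Pr S δ J κ) (hκ : κ ≤ 1) (hKJ : K < J) (hu1 : 1 < u) (huM : u ≤ M)
    (hL : 0 < L) (hεM : M * ε ≤ 1 / 4) (hε : 0 < ε) (hK : u * L ≤ K)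
    (hσ : ∑ p ∈ Pr, δ p ≤ (1 + ε) * L + 1) :
    ((𝒜.filter fun x => K ≤ (S x).card).card : ℝ) ≤
      𝒜.card * (2 * Real.exp M * Real.exp (-(logEntropy u - 1 / 2) * L)) := by
  have h1 := hI.card_large_mul_pow_le hKJ hu1.le
  set σ := ∑ p ∈ Pr, δ p
  have h2 : Real.exp (u * L * Real.log u) ≤ u ^ K := by
    rw [← Real.rpow_natCast, Real.rpow_def_of_pos (by linarith), mul_comm (Real.log u)]
    exact Real.exp_le_exp.mpr (mul_le_mul_of_nonneg_right hK (Real.log_pos hu1).le)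
  have h4 : Real.exp ((u - 1) * σ) ≤ Real.exp M * Real.exp (-(logEntropy u - 1 / 2) * L) *
      Real.exp (u * L * Real.log u) := by
    rw [← Real.exp_add, ← Real.exp_add]
    apply Real.exp_le_exp.mpr
    have h5 : (u - 1) * σ ≤ (u - 1) * ((1 + ε) * L + 1) :=
      mul_le_mul_of_nonneg_left hσ (by linarith)
    have h6 : (u - 1) * ε * L ≤ 1 / 4 * L := by
      refine mul_le_mul_of_nonneg_right ?_ hL.le
      nlinarith
    rw [logEntropy]
    linarith
  have h3 : (1 + κ) * Real.exp ((u - 1) * σ) ≤ 2 * (Real.exp M *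
      Real.exp (-(logEntropy u - 1 / 2) * L) * Real.exp (u * L * Real.log u)) :=
    mul_le_mul (by linarith) h4 (Real.exp_pos _).le (by norm_num)
  refine le_of_mul_le_mul_right ?_ (Real.exp_pos (u * L * Real.log u))
  calc _ ≤ ((𝒜.filter fun x => K ≤ (S x).card).card : ℝ) * u ^ K :=
        mul_le_mul_of_nonneg_left h2 (Nat.cast_nonneg _)
    _ ≤ _ := h1
    _ ≤ 𝒜.card * (2 * (Real.exp M *
      Real.exp (-(logEntropy u - 1 / 2) * L) * Real.exp (u * L * Real.log u))) :=
        mul_le_mul_of_nonneg_left h3 (Nat.cast_nonneg _)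
    _ = _ := by ring

/-- The contribution of the tuples whose determinants have few prime divisors in total. The
relation `u log m = m - 1` makes the exponent agree with that of
`NearlyIndependent.card_large_le`. -/
theorem card_few_primes_le {m n H J K : ℕ} {Pr : Finset ℕ} {κ u L ε : ℝ} (hm : 2 ≤ m)
    (hI : NearlyIndependent (matrixBox n H) Pr (detPrimes Pr) (singularDensity n) J κ)
    (hκ : κ ≤ Real.exp (-(3 * L))) (hJodd : Odd J) (hu1 : 1 < u) (hum : u < m)
    (hu : u * Real.log m = m - 1) (hL : 0 < L) (hεm : m * ε = 1 / 4) (hε : 0 < ε)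
    (hKup : (K : ℝ) ≤ u * L + 1) (hJlo : 7 * L ≤ J)
    (hσlo : (1 - ε) * L ≤ ∑ p ∈ Pr, singularDensity n p)
    (hσup : ∑ p ∈ Pr, singularDensity n p ≤ 2 * L) :
    (((Fintype.piFinset fun _ : Fin m => matrixBox n H).filter fun A =>
        ∑ i, (detPrimes Pr (A i)).card < K).card : ℝ) ≤
      ((matrixBox n H).card : ℝ) ^ m *
        (3 ^ m * m * Real.exp (-(logEntropy u - 1 / 2) * L)) := by
  have hm0 : (2 : ℝ) ≤ m := by exact_mod_cast hm
  set y := u / m with hy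
  have hy0 : 0 < y := by positivity
  have hy1 : y < 1 := by rw [hy, div_lt_one (by positivity)]; exact hum
  have h1 := card_few_primes_mul_pow_le (m := m) (n := n) (H := H) Pr K hy0.le hy1.le
  have h2 := hI.sum_pow_card_le hJodd (t := 1 - y) (by linarith) (by linarith)
  rw [sub_sub_cancel] at h2
  set σ := ∑ p ∈ Pr, singularDensity n p
  set W := Real.exp (-(logEntropy u - 1 / 2) * L) with hW
  set G := Real.exp (-((1 - y) * ((1 - ε) * L))) with hG
  have hG0 : 0 < G := Real.exp_pos _
  have hε1 : ε ≤ 1 / 8 := by nlinarith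
  have hGL : Real.exp (-L) ≤ G := by
    apply Real.exp_le_exp.mpr
    have h0 : (1 - ε) * L ≤ 1 * L := mul_le_mul_of_nonneg_right (by linarith) hL.le
    have h0' : 0 ≤ (1 - ε) * L := mul_nonneg (by linarith) hL.le
    have : (1 - y) * ((1 - ε) * L) ≤ 1 * ((1 - ε) * L) :=
      mul_le_mul_of_nonneg_right (by linarith) h0'
    linarith
  have h3 : Real.exp (-((1 - y) * σ)) ≤ G :=
    Real.exp_le_exp.mpr (neg_le_neg (mul_le_mul_of_nonneg_left hσlo (by linarith)))
  have hσ0 : 0 ≤ σ := Finset.sum_nonneg fun p _ => singularDensity_nonneg n p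
  have h4 : Real.exp (Real.exp 1 * σ - J) ≤ G := by
    refine le_trans (Real.exp_le_exp.mpr ?_) hGL
    have he3 : Real.exp 1 ≤ 3 := by linarith [Real.exp_one_lt_d9]
    have : Real.exp 1 * σ ≤ 3 * (2 * L) := mul_le_mul he3 hσup hσ0 (by norm_num)
    linarith
  have h5 : κ * Real.exp σ ≤ G := by
    refine le_trans ?_ hGL
    calc κ * Real.exp σ ≤ Real.exp (-(3 * L)) * Real.exp (2 * L) := by gcongr
      _ = Real.exp (-L) := by rw [← Real.exp_add]; congr 1; ring
  have h6 : ∑ A ∈ matrixBox n H, y ^ (detPrimes Pr A).card ≤ (matrixBox n H).card * (3 * G) := by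
    refine h2.trans (mul_le_mul_of_nonneg_left ?_ (Nat.cast_nonneg _))
    linarith
  have h7 : (∑ A ∈ matrixBox n H, y ^ (detPrimes Pr A).card) ^ m ≤
      ((matrixBox n H).card : ℝ) ^ m * (3 ^ m * G ^ m) := by
    calc _ ≤ ((matrixBox n H).card * (3 * G)) ^ m :=
          pow_le_pow_left₀ (Finset.sum_nonneg fun A _ => pow_nonneg hy0.le _) h6 m
      _ = ((matrixBox n H).card : ℝ) ^ m * (3 ^ m * G ^ m) := by rw [mul_pow, mul_pow]
  have h8 : y * Real.exp (u * L * Real.log y) ≤ y ^ K := by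
    have e : y * Real.exp (u * L * Real.log y) = Real.exp (Real.log y * (u * L + 1)) := by
      rw [mul_add, mul_one, Real.exp_add, Real.exp_log hy0, mul_comm y]
      congr 2; ring
    rw [e, ← Real.rpow_natCast, Real.rpow_def_of_pos hy0]
    apply Real.exp_le_exp.mpr
    exact mul_le_mul_of_nonpos_left hKup (Real.log_nonpos hy0.le hy1.le)
  have h9 : G ^ m ≤ W * Real.exp (u * L * Real.log y) := by
    rw [hG, hW, ← Real.exp_nat_mul, ← Real.exp_add]
    apply Real.exp_le_exp.mpr
    have e1 : Real.log y = Real.log u - Real.log m := by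
      rw [hy, Real.log_div (by linarith) (by positivity)]
    have e2 : (m : ℝ) * (1 - y) = m - u := by rw [hy]; field_simp
    have e3 : u * L * Real.log y = L * (u * Real.log u) - L * (m - 1) := by
      rw [e1, ← hu]; ring
    have e4 : (m : ℝ) * -((1 - y) * ((1 - ε) * L)) = -((m - u) * (1 - ε) * L) := by
      rw [← e2]; ring
    rw [e3, e4, logEntropy]
    have h10 : (m - u) * ε * L ≤ 1 / 4 * L := by
      refine mul_le_mul_of_nonneg_right ?_ hL.le
      nlinarith
    linarith
  have hy_inv : 1 ≤ m * y := by rw [hy, mul_div_cancel₀ _ (by positivity)]; exact hu1.le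
  have hpos : 0 < y * Real.exp (u * L * Real.log y) := by positivity
  refine le_of_mul_le_mul_right ?_ hpos
  calc _ ≤ (((Fintype.piFinset fun _ : Fin m => matrixBox n H).filter fun A =>
        ∑ i, (detPrimes Pr (A i)).card < K).card : ℝ) * y ^ K :=
        mul_le_mul_of_nonneg_left h8 (Nat.cast_nonneg _)
    _ ≤ _ := h1.trans h7
    _ ≤ ((matrixBox n H).card : ℝ) ^ m * (3 ^ m * (W * Real.exp (u * L * Real.log y))) * 1 := by
        rw [mul_one]; gcongr
    _ ≤ ((matrixBox n H).card : ℝ) ^ m * (3 ^ m * (W * Real.exp (u * L * Real.log y))) *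
          (m * y) := mul_le_mul_of_nonneg_left hy_inv (by positivity)
    _ = _ := by ring

/-- The determinants of the matrices in a box of side at least `H = exp (exp L)` are equidistributed
with respect to products of `O(L)` primes up to `exp (exp L / L ^ 2)`. -/
theorem exists_nearlyIndependent {m n H J : ℕ} {L : ℝ} (hH : (H : ℝ) = Real.exp (Real.exp L))
    {Pr : Finset ℕ} (hprime : ∀ p ∈ Pr, p.Prime)
    (hPr : ∀ p ∈ Pr, (p : ℝ) ≤ Real.exp (Real.exp L / L ^ 2))
    (hL : 4 * m + 18 ≤ L) (hLexp : (n : ℝ) ^ 2 * Real.log 2 + 1 + 4 * L ≤ Real.exp L / 2)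
    (hJup : (J : ℝ) ≤ (2 * m + 9) * L) (T : ℕ) (hT : H ≤ T) :
    ∃ κ : ℝ, κ ≤ Real.exp (-(3 * L)) ∧
      NearlyIndependent (matrixBox n T) Pr (detPrimes Pr) (singularDensity n) J κ := by
  have hL0 : 0 < L := by linarith [Nat.cast_nonneg (α := ℝ) m]
  have hsqrt : Real.exp (Real.exp L / 2) * Real.exp (Real.exp L / 2) = H := by
    rw [hH, ← Real.exp_add]; congr 1; ring
  have hRone : 1 ≤ Real.exp (Real.exp L / 2) := Real.one_le_exp (by positivity)
  have hR : ∀ D ⊆ Pr, D.card < J → ((∏ p ∈ D, p : ℕ) : ℝ) ≤ Real.exp (Real.exp L / 2) := by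
    intro D hD hDJ
    rw [Nat.cast_prod]
    calc ∏ p ∈ D, (p : ℝ) ≤ ∏ _p ∈ D, Real.exp (Real.exp L / L ^ 2) :=
          Finset.prod_le_prod (fun p _ => by positivity) fun p hp => hPr p (hD hp)
      _ = Real.exp (D.card * (Real.exp L / L ^ 2)) := by
          rw [Finset.prod_const, ← Real.exp_nat_mul]
      _ ≤ Real.exp (Real.exp L / 2) := by
          apply Real.exp_le_exp.mpr
          have h1 : (D.card : ℝ) ≤ (2 * m + 9) * L :=
            le_trans (by exact_mod_cast hDJ.le) hJup
          have h2 : (D.card : ℝ) ≤ L ^ 2 / 2 := by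
            have := mul_le_mul_of_nonneg_right (by linarith : 2 * (m : ℝ) + 9 ≤ L / 2) hL0.le
            linarith
          calc (D.card : ℝ) * (Real.exp L / L ^ 2) ≤ L ^ 2 / 2 * (Real.exp L / L ^ 2) := by gcongr
            _ = Real.exp L / 2 := by field_simp
  have hT' : (H : ℝ) ≤ T := by exact_mod_cast hT
  have hHpos : 0 < (H : ℝ) := by rw [hH]; positivity
  refine ⟨_, ?_, nearlyIndependent_matrixBox hprime (Real.exp_pos _).le hR ?_⟩
  swap
  · have := le_mul_of_one_le_left (Real.exp_pos (Real.exp L / 2)).le hRone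
    linarith
  calc 2 ^ (n ^ 2) * Real.exp (Real.exp L / 2) / (2 * T + 1)
      ≤ 2 ^ (n ^ 2) * Real.exp (Real.exp L / 2) / H := by gcongr; linarith
    _ = 2 ^ (n ^ 2) * Real.exp (-(Real.exp L / 2)) := by
        rw [← hsqrt, Real.exp_neg]; field_simp
    _ = Real.exp ((n : ℝ) ^ 2 * Real.log 2 - Real.exp L / 2) := by
        rw [sub_eq_add_neg, Real.exp_add, mul_comm ((n : ℝ) ^ 2), Real.exp_mul,
          Real.exp_log (by norm_num)]
        congr 1
        exact_mod_cast (Real.rpow_natCast 2 (n ^ 2)).symm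
    _ ≤ _ := Real.exp_le_exp.mpr (by linarith)

/-- The upper bound for a fixed `H`, once the primes are chosen. The exponent falls short of
`u log u - u + 1` by `1 / 2`, which pays for the error `L / (4 m)` in the reciprocal sum. -/
theorem ncard_productSet_le_of_primes {m n H : ℕ} (hm : 2 ≤ m) (hn : 1 ≤ n) {u L : ℝ} (hu1 : 1 < u)
    (hum : u < m) (hu : u * Real.log m = m - 1) (hH : (H : ℝ) = Real.exp (Real.exp L))
    {Pr : Finset ℕ} (hPr : ∀ p ∈ Pr, p.Prime ∧
      Real.exp ((|logEntropy u| + 1) * L) ≤ p ∧ (p : ℝ) ≤ Real.exp (Real.exp L / L ^ 2))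
    (hlo : (1 - 1 / (4 * m : ℝ)) * L ≤ ∑ p ∈ Pr, (1 : ℝ) / p)
    (hup : ∑ p ∈ Pr, (1 : ℝ) / p ≤ (1 + 1 / (4 * m : ℝ)) * L)
    (hL : 4 * m + 18 ≤ L) (hLexp : (n : ℝ) ^ 2 * Real.log 2 + 1 + 4 * L ≤ Real.exp L / 2) :
    ((productSet m n H).ncard : ℝ) ≤
      (32 * m ^ 2 * 3 ^ (m * n ^ 2) + (3 * n ^ (m - 1)) ^ (n ^ 2) * 2 * Real.exp m +
        3 ^ (m * n ^ 2) * 3 ^ m * m) *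
        ((H : ℝ) ^ (m * n ^ 2) * Real.exp (-(logEntropy u - 1 / 2) * L)) := by
  have hm0 : (2 : ℝ) ≤ m := by exact_mod_cast hm
  have hL0 : 0 < L := by linarith
  have hprime : ∀ p ∈ Pr, p.Prime := fun p hp => (hPr p hp).1
  set ε : ℝ := 1 / (4 * m : ℝ) with hε
  have hε0 : 0 < ε := by positivity
  have hεm : m * ε = 1 / 4 := by rw [hε]; field_simp
  have hε1 : ε ≤ 1 / 8 := by nlinarith
  set Q := logEntropy u with hQ
  have hQdef : Q = u * Real.log u - u + 1 := rfl
  set σ := ∑ p ∈ Pr, singularDensity n p with hσ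
  have hσlo : (1 - ε) * L ≤ σ :=
    hlo.trans (Finset.sum_le_sum fun p hp => one_div_le_singularDensity hn (hprime p hp))
  have hLe : 4 * L ≤ Real.exp L := by
    have : 0 ≤ (n : ℝ) ^ 2 * Real.log 2 := by
      have := Real.log_nonneg (by norm_num : (1 : ℝ) ≤ 2); positivity
    linarith [Real.exp_pos L]
  have hsq : ∑ p ∈ Pr, (1 : ℝ) / p ^ 2 ≤ 2 * L * Real.exp (-((|Q| + 1) * L)) := by
    calc ∑ p ∈ Pr, (1 : ℝ) / p ^ 2
        ≤ ∑ p ∈ Pr, (1 : ℝ) / p * Real.exp (-((|Q| + 1) * L)) := by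
          refine Finset.sum_le_sum fun p hp => ?_
          rw [sq, ← one_div_mul_one_div, Real.exp_neg, ← one_div]
          have := one_div_le_one_div_of_le (Real.exp_pos _) (hPr p hp).2.1
          gcongr
      _ = (∑ p ∈ Pr, (1 : ℝ) / p) * Real.exp (-((|Q| + 1) * L)) := by rw [Finset.sum_mul]
      _ ≤ _ := by
          gcongr
          nlinarith
  have hdecay : L * Real.exp (-((|Q| + 1) * L)) ≤ Real.exp (-Q * L) := by
    have h1 : L ≤ Real.exp L := by linarith
    calc L * Real.exp (-((|Q| + 1) * L)) ≤ Real.exp L * Real.exp (-((|Q| + 1) * L)) := by gcongr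
      _ = Real.exp (-|Q| * L) := by rw [← Real.exp_add]; congr 1; ring
      _ ≤ _ := by
          apply Real.exp_le_exp.mpr
          have := le_abs_self Q
          nlinarith
  have hdecay1 : 4 * (L * Real.exp (-((|Q| + 1) * L))) ≤ 1 := by
    calc 4 * (L * Real.exp (-((|Q| + 1) * L))) ≤ Real.exp L * Real.exp (-((|Q| + 1) * L)) := by
          rw [← mul_assoc]; gcongr
      _ = Real.exp (-(|Q| * L)) := by rw [← Real.exp_add]; congr 1; ring
      _ ≤ 1 := Real.exp_le_one_iff.mpr (by have := abs_nonneg Q; nlinarith [mul_nonneg this hL0.le])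
  have hσup : σ ≤ (1 + ε) * L + 1 := by
    have h1 : σ ≤ ∑ p ∈ Pr, ((1 : ℝ) / p + 2 * (1 / p ^ 2)) :=
      Finset.sum_le_sum fun p hp =>
        (singularDensity_prime_le (hprime p hp)).trans (le_of_eq (by ring))
    rw [Finset.sum_add_distrib, ← Finset.mul_sum] at h1
    linarith
  have hσup' : σ ≤ 2 * L := by nlinarith
  -- `K` is where the bounds for many and for few prime divisors balance. `J` exceeds `K`, is odd
  -- for the Bonferroni inequality, and at least `7 L` to make the truncation error `exp (-L)`.
  set J := 2 * ⌈(m + 3) * L⌉₊ + 1 with hJ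
  set K := ⌈u * L⌉₊ with hK
  have hKJ : K < J := by
    have : K ≤ ⌈(m + 3) * L⌉₊ := Nat.ceil_le_ceil (by nlinarith)
    omega
  have hJodd : Odd J := ⟨_, rfl⟩
  have hJlo : 2 * ((m + 3) * L) ≤ J := by
    have := Nat.le_ceil ((m + 3) * L)
    rw [hJ]; push_cast; linarith
  have hJlo' : 7 * L ≤ J := by nlinarith
  have hJup : (J : ℝ) ≤ (2 * m + 9) * L := by
    have := Nat.ceil_lt_add_one (a := (m + 3) * L) (by positivity)
    rw [hJ]; push_cast; nlinarith
  have hKlo : u * L ≤ K := Nat.le_ceil _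
  have hKup : (K : ℝ) ≤ u * L + 1 := (Nat.ceil_lt_add_one (by positivity)).le
  have hnear := exists_nearlyIndependent (n := n) hH hprime (fun p hp => (hPr p hp).2.2) hL
    hLexp hJup
  have hκ1 : Real.exp (-(3 * L)) ≤ 1 := Real.exp_le_one_iff.mpr (by linarith)
  have hH1 : 1 ≤ H := by
    have : (1 : ℝ) ≤ H := by rw [hH]; exact Real.one_le_exp (by positivity)
    exact_mod_cast this
  have hHT : H ≤ n ^ (m - 1) * H ^ m :=
    calc H = 1 * H ^ 1 := by simp
      _ ≤ n ^ (m - 1) * H ^ m :=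
        Nat.mul_le_mul (Nat.one_le_pow _ _ hn) (Nat.pow_le_pow_right hH1 (by omega))
  obtain ⟨κ, hκ, hI⟩ := hnear H le_rfl
  obtain ⟨κ', hκ', hI'⟩ := hnear _ hHT
  have hcardm : ((matrixBox n H).card : ℝ) ^ m ≤ 3 ^ (m * n ^ 2) * (H : ℝ) ^ (m * n ^ 2) := by
    rw [card_matrixBox]
    have h1 : ((2 * H + 1 : ℕ) : ℝ) ≤ 3 * H := by
      have : (1 : ℝ) ≤ H := by exact_mod_cast hH1
      push_cast; linarith
    rw [Nat.cast_pow, ← pow_mul, mul_comm (n ^ 2) m, ← mul_pow]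
    gcongr
  have hcardT : ((matrixBox n (n ^ (m - 1) * H ^ m)).card : ℝ) ≤
      (3 * n ^ (m - 1)) ^ (n ^ 2) * (H : ℝ) ^ (m * n ^ 2) := by
    rw [card_matrixBox]
    have h1 : ((2 * (n ^ (m - 1) * H ^ m) + 1 : ℕ) : ℝ) ≤ 3 * n ^ (m - 1) * H ^ m := by
      have : (1 : ℝ) ≤ n ^ (m - 1) * H ^ m := by exact_mod_cast hH1.trans hHT
      push_cast; linarith
    rw [Nat.cast_pow, pow_mul, ← mul_pow]
    gcongr
  set W := Real.exp (-(Q - 1 / 2) * L) with hW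
  have hW0 : 0 < W := Real.exp_pos _
  set HH := (H : ℝ) ^ (m * n ^ 2) with hHH
  have hJ1 : 1 < J := by exact_mod_cast (by linarith : (1 : ℝ) < J)
  have hE1 := card_common_prime_le_sum_inv_sq (m := m) hprime hJ1 (hκ.trans hκ1) hI
  have hE1' : 16 * (m : ℝ) ^ 2 * ((matrixBox n H).card : ℝ) ^ m * ∑ p ∈ Pr, (1 : ℝ) / p ^ 2 ≤
      16 * m ^ 2 * (3 ^ (m * n ^ 2) * HH) * (2 * W) := by
    have h1 : Real.exp (-Q * L) ≤ W := Real.exp_le_exp.mpr (by linarith)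
    have h2 : ∑ p ∈ Pr, (1 : ℝ) / p ^ 2 ≤ 2 * W := by linarith
    gcongr
  have hE2 := hI'.card_large_le (hκ'.trans hκ1) hKJ hu1 hum.le hL0 hεm.le hε0 hKlo hσup
  have hE2' := mul_le_mul_of_nonneg_right hcardT
    (by positivity : 0 ≤ 2 * Real.exp m * W)
  have hE3 := card_few_primes_le hm hI hκ hJodd hu1 hum hu hL0 hεm hε0 hKup hJlo' hσlo hσup'
  have hE3' := mul_le_mul_of_nonneg_right hcardm
    (by positivity : 0 ≤ 3 ^ m * (m : ℝ) * W)
  have hfinal := ncard_productSet_le_add (m := m) (n := n) (H := H) (by omega) Pr K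
  have hfinal' : ((productSet m n H).ncard : ℝ) ≤ _ := Nat.cast_le.mpr hfinal
  push_cast at hfinal'
  calc _ ≤ _ := hfinal'
    _ ≤ _ := add_le_add (add_le_add (hE1.trans hE1') (hE2.trans hE2')) (hE3.trans hE3')
    _ = _ := by ring

/-! ### The lower bound -/

theorem mul_diagonal_mem_productSet {k n H : ℕ} (M : Matrix (Fin n) (Fin n) ℤ)
    (hM : M ∈ boundedMatrices n H) (S : Fin n → Finset ℕ) (hS : ∀ j, (S j).card = k)
    (hSH : ∀ j, ∀ p ∈ S j, p ≤ H) :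
    M * Matrix.diagonal (fun j => ((∏ p ∈ S j, p : ℕ) : ℤ)) ∈ productSet (k + 1) n H := by
  let d : Fin k → Fin n → ℤ := fun i j => ((S j).orderEmbOfFin (hS j) i : ℕ)
  refine ⟨Fin.cons M fun i => Matrix.diagonal (d i), fun i => ?_, ?_⟩
  · refine Fin.cases hM (fun i => ?_) i
    intro a b
    simp only [Fin.cons_succ, Matrix.diagonal_apply]
    split_ifs
    · have := hSH a _ ((S a).orderEmbOfFin_mem (hS a) i)
      simp only [d, Nat.abs_cast]
      exact_mod_cast this
    · simp
  · rw [List.ofFn_succ, List.prod_cons]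
    simp only [Fin.cons_zero, Fin.cons_succ]
    congr 1
    have h := map_list_prod (Matrix.diagonalRingHom (Fin n) ℤ) (List.ofFn d)
    rw [List.map_ofFn, List.prod_ofFn] at h
    have e : (Matrix.diagonalRingHom (Fin n) ℤ ∘ d) = fun i => Matrix.diagonal (d i) := rfl
    rw [← e, ← h]
    change Matrix.diagonal _ = _
    congr 1
    funext j
    rw [Finset.prod_apply]
    simp only [d]
    rw [← Nat.cast_prod]
    congr 1
    rw [← Finset.prod_coe_sort (S j)]
    exact Fintype.prod_equiv ((S j).orderIsoOfFin (hS j)).toEquiv _ _ fun i => rfl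

/-- Products `M * D` with `D` diagonal. The entries of `D` are products of distinct primes from a
set `P`, those of the first row of `M` are primes outside `P`, so that the first row of `M * D`
determines `D`. -/
theorem card_le_ncard_productSet {k n H : ℕ} (hn : 1 ≤ n) (P B : Finset ℕ)
    (hP : ∀ p ∈ P, p.Prime ∧ p ≤ H) (hB : ∀ p ∈ B, p.Prime ∧ p ≤ H) (hdisj : Disjoint P B) :
    B.card ^ n * (2 * H + 1) ^ (n * (n - 1)) * (P.card.choose k) ^ n ≤
      (productSet (k + 1) n H).ncard := by
  classical
  let i₀ : Fin n := ⟨0, hn⟩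
  let s : Fin n → Fin n → Finset ℤ := fun i _ =>
    if i = i₀ then B.image fun p : ℕ => (p : ℤ) else Finset.Icc (-(H : ℤ)) H
  let X : Finset (Matrix (Fin n) (Fin n) ℤ × (Fin n → Finset ℕ)) :=
    entryBox s ×ˢ Fintype.piFinset fun _ => P.powersetCard k
  let f : Matrix (Fin n) (Fin n) ℤ × (Fin n → Finset ℕ) → Matrix (Fin n) (Fin n) ℤ := fun x =>
    x.1 * Matrix.diagonal fun j => ((∏ p ∈ x.2 j, p : ℕ) : ℤ)
  have hcard : X.card = B.card ^ n * (2 * H + 1) ^ (n * (n - 1)) * (P.card.choose k) ^ n := by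
    simp only [X, Finset.card_product, card_entryBox, Fintype.card_piFinset,
      Finset.card_powersetCard, Finset.prod_const, Finset.card_univ, Fintype.card_fin]
    congr 1
    rw [← Finset.mul_prod_erase _ _ (Finset.mem_univ i₀)]
    congr 1
    · simp only [s, if_true]
      rw [Finset.card_image_of_injective _ Nat.cast_injective, Finset.prod_const,
        Finset.card_univ, Fintype.card_fin]
    · have : ∀ i ∈ Finset.univ.erase i₀, ∏ j, (s i j).card = (2 * H + 1) ^ n := by
        intro i hi
        simp only [s, if_neg (Finset.ne_of_mem_erase hi), Int.card_Icc, Finset.prod_const,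
          Finset.card_univ, Fintype.card_fin]
        congr 1
        omega
      rw [Finset.prod_congr rfl this, Finset.prod_const, Finset.card_erase_of_mem
        (Finset.mem_univ _), Finset.card_univ, Fintype.card_fin, ← pow_mul]
  have hmemS : ∀ x ∈ X, ∀ j, x.2 j ⊆ P ∧ (x.2 j).card = k := fun x hx j =>
    Finset.mem_powersetCard.mp (Fintype.mem_piFinset.mp (Finset.mem_product.mp hx).2 j)
  have hmemM : ∀ x ∈ X, ∀ i j, x.1 i j ∈ s i j := fun x hx =>
    mem_entryBox.mp (Finset.mem_product.mp hx).1
  have hrow : ∀ x ∈ X, ∀ j, ∃ q ∈ B, (q : ℤ) = x.1 i₀ j := by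
    intro x hx j
    have := hmemM x hx i₀ j
    simp only [s, if_true] at this
    simpa using this
  have hmaps : ∀ x ∈ X, f x ∈ productSet (k + 1) n H := by
    intro x hx
    refine mul_diagonal_mem_productSet x.1 (fun i j => ?_) x.2 (fun j => (hmemS x hx j).2)
      fun j p hp => (hP p ((hmemS x hx j).1 hp)).2
    by_cases hi : i = i₀
    · obtain ⟨q, hq, hq'⟩ := hrow x hx j
      rw [hi, ← hq', Nat.abs_cast]
      exact_mod_cast (hB q hq).2
    · have := hmemM x hx i j
      simp only [s, if_neg hi, Finset.mem_Icc] at this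
      exact abs_le.mpr this
  have happ : ∀ x : Matrix (Fin n) (Fin n) ℤ × (Fin n → Finset ℕ), ∀ i j,
      f x i j = x.1 i j * ((∏ p ∈ x.2 j, p : ℕ) : ℤ) := fun x i j => by
    simp only [f, Matrix.mul_diagonal]
  have hfactors : ∀ x ∈ X, ∀ j, (f x i₀ j).natAbs.primeFactors ∩ P = x.2 j := by
    intro x hx j
    obtain ⟨q, hq, hq'⟩ := hrow x hx j
    have hSP : ∀ p ∈ x.2 j, p.Prime := fun p hp => (hP p ((hmemS x hx j).1 hp)).1
    rw [happ, ← hq', Int.natAbs_mul, Int.natAbs_natCast, Int.natAbs_natCast,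
      Nat.primeFactors_mul (hB q hq).1.ne_zero (Finset.prod_ne_zero_iff.mpr fun p hp =>
        (hSP p hp).ne_zero), Nat.primeFactors_prod hSP, (hB q hq).1.primeFactors]
    ext p
    simp only [Finset.mem_inter, Finset.mem_union, Finset.mem_singleton]
    constructor
    · rintro ⟨rfl | h, h2⟩
      · exact absurd hq (Finset.disjoint_left.mp hdisj h2)
      · exact h
    · exact fun h => ⟨Or.inr h, (hmemS x hx j).1 h⟩
  have hinj : Set.InjOn f X := by
    intro x hx y hy hxy
    have h2 : x.2 = y.2 := by
      funext j
      rw [← hfactors x hx j, ← hfactors y hy j, hxy]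
    refine Prod.ext ?_ h2
    ext i j
    have h3 : f x i j = f y i j := by rw [hxy]
    rw [happ, happ, h2] at h3
    refine mul_right_cancel₀ ?_ h3
    rw [Nat.cast_ne_zero, Finset.prod_ne_zero_iff]
    exact fun p hp => (hP p ((hmemS y hy j).1 hp)).1.ne_zero
  rw [← hcard, ← Finset.card_image_of_injOn hinj, ← Set.ncard_coe_finset]
  refine Set.ncard_le_ncard ?_ (productSet_finite _ _ _)
  intro C hC
  obtain ⟨x, hx, rfl⟩ := Finset.mem_image.mp (Finset.mem_coe.mp hC)
  exact hmaps x hx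

theorem eventually_rpow_le_primeCounting {η : ℝ} (hη : 0 < η) :
    ∀ᶠ H : ℕ in atTop, 4 * (H : ℝ) ^ (1 - η) ≤ H.primeCounting := by
  have hcast := tendsto_natCast_atTop_atTop (R := ℝ)
  have h1 : ∀ᶠ x : ℝ in atTop, Real.log x ≤ 1 / 32 * x ^ η := by
    filter_upwards [(isLittleO_log_rpow_atTop hη).bound (by norm_num : (0 : ℝ) < 1 / 32),
      eventually_ge_atTop 1] with x hx hx1
    rw [Real.norm_of_nonneg (Real.log_nonneg hx1), Real.norm_of_nonneg (by positivity)] at hx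
    exact hx
  have h2 : ∀ᶠ x : ℝ in atTop, Real.log x ≤ 1 / 32 * x ^ (1 : ℝ) := by
    filter_upwards [(isLittleO_log_rpow_atTop zero_lt_one).bound (by norm_num : (0 : ℝ) < 1 / 32),
      eventually_ge_atTop 1] with x hx hx1
    rw [Real.norm_of_nonneg (Real.log_nonneg hx1), Real.norm_of_nonneg (by positivity)] at hx
    exact hx
  filter_upwards [hcast.eventually h1, hcast.eventually h2, eventually_ge_atTop 2] with H h1 h2 hH
  have hH2 : (2 : ℝ) ≤ H := by exact_mod_cast hH
  have hlog : 0 < Real.log H := Real.log_pos (by linarith)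
  rw [Real.rpow_one] at h2
  refine le_trans ?_ (Chebyshev.pi_ge H)
  rw [le_div_iff₀ hlog]
  have h3 : Real.log ((H : ℝ) + 1) ≤ 2 * Real.log H := by
    rw [← Real.log_rpow (by linarith) (2 : ℝ)]
    apply Real.log_le_log (by positivity)
    rw [Real.rpow_two]
    nlinarith
  have h4 : (H : ℝ) ^ (1 - η) * (H : ℝ) ^ η = H := by
    rw [← Real.rpow_add (by linarith)]; simp
  have h5 : (H : ℝ) ^ (1 - η) * Real.log H ≤ (H : ℝ) ^ (1 - η) * (1 / 32 * (H : ℝ) ^ η) :=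
    mul_le_mul_of_nonneg_left h1 (by positivity)
  have h6 : (H : ℝ) * (1 / 2) ≤ H * Real.log 2 :=
    mul_le_mul_of_nonneg_left (by linarith [Real.log_two_gt_d9]) (by linarith)
  linarith

/-- The lower bound, up to an arbitrarily small power of `H`. -/
theorem eventually_rpow_le_ncard_productSet {m n : ℕ} (hm : 1 ≤ m) (hn : 1 ≤ n) {ε : ℝ}
    (hε : 0 < ε) :
    ∀ᶠ H : ℕ in atTop,
      (H : ℝ) ^ ((n : ℝ) ^ 2 + m * n - n - ε) ≤ ((productSet m n H).ncard : ℝ) := by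
  obtain ⟨k, rfl⟩ : ∃ k, m = k + 1 := ⟨m - 1, by omega⟩
  set r : ℕ := n * (k + 1) with hr
  have hr0 : (0 : ℝ) < r := by rw [hr]; positivity
  set η : ℝ := min (ε / (2 * r)) (1 / 2) with hη
  have hη0 : 0 < η := by positivity
  have hη1 : η ≤ 1 / 2 := min_le_right _ _
  have hηr : r * η ≤ ε / 2 := by
    calc r * η ≤ r * (ε / (2 * r)) := by gcongr; exact min_le_left _ _
      _ = ε / 2 := by field_simp
  set c : ℝ := ((1 / 2) ^ k / (k.factorial : ℝ)) ^ n with hc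
  have hc0 : 0 < c := by positivity
  have hbig1 : ∀ᶠ H : ℕ in atTop, c⁻¹ ≤ (H : ℝ) ^ (ε / 2) :=
    ((tendsto_rpow_atTop (half_pos hε)).comp tendsto_natCast_atTop_atTop).eventually_ge_atTop _
  have hbig2 : ∀ᶠ H : ℕ in atTop, 2 * (k : ℝ) + 1 ≤ (H : ℝ) ^ (1 - η) :=
    ((tendsto_rpow_atTop (by linarith : 0 < 1 - η)).comp
      tendsto_natCast_atTop_atTop).eventually_ge_atTop _
  filter_upwards [eventually_rpow_le_primeCounting hη0, hbig1, hbig2, eventually_ge_atTop 1]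
    with H h1 h2 h3 hH
  have hH1 : (1 : ℝ) ≤ H := by exact_mod_cast hH
  have hH0 : (0 : ℝ) < H := by linarith
  set x : ℝ := (H : ℝ) ^ (1 - η) with hx
  have hx1 : 1 ≤ x := by linarith [Nat.cast_nonneg (α := ℝ) k]
  have hpi : (H.primesLE).card = H.primeCounting := by
    rw [Nat.primesLE, Nat.primesBelow_card_eq_primeCounting']; rfl
  set a := H.primeCounting / 2 with ha
  obtain ⟨P, hPsub, hPcard⟩ := Finset.exists_subset_card_eq (s := H.primesLE) (n := a)
    (by rw [hpi]; omega)
  have hBcard : a ≤ (H.primesLE \ P).card := by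
    rw [Finset.card_sdiff_of_subset hPsub, hpi, hPcard]; omega
  have hax : x ≤ a := by
    have : (H.primeCounting : ℝ) ≤ 2 * a + 1 := by
      exact_mod_cast (by omega : H.primeCounting ≤ 2 * a + 1)
    linarith
  have hmain := card_le_ncard_productSet (k := k) (H := H) hn P (H.primesLE \ P)
    (fun p hp => ((Nat.mem_primesLE.mp (hPsub hp)).symm))
    (fun p hp => (Nat.mem_primesLE.mp (Finset.mem_sdiff.mp hp).1).symm) Finset.disjoint_sdiff
  have hchoose : (1 / 2) ^ k / (k.factorial : ℝ) * x ^ k ≤ (P.card.choose k : ℝ) := by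
    rw [hPcard]
    refine le_trans ?_ (Nat.pow_le_choose k a)
    have hka : k ≤ a + 1 := by
      have : (k : ℝ) ≤ a + 1 := by linarith [Nat.cast_nonneg (α := ℝ) k]
      exact_mod_cast this
    rw [Nat.cast_sub hka, div_mul_eq_mul_div, ← mul_pow]
    gcongr
    push_cast
    linarith
  have hmain' : ((H.primesLE \ P).card : ℝ) ^ n * (2 * H + 1) ^ (n * (n - 1)) *
      (P.card.choose k : ℝ) ^ n ≤ ((productSet (k + 1) n H).ncard : ℝ) := by
    exact_mod_cast hmain
  refine le_trans ?_ hmain'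
  have hBx : x ≤ ((H.primesLE \ P).card : ℝ) := hax.trans (by exact_mod_cast hBcard)
  calc (H : ℝ) ^ ((n : ℝ) ^ 2 + ((k + 1 : ℕ) : ℝ) * n - n - ε)
      ≤ c * ((H : ℝ) ^ ((1 - η) * r) * (H : ℝ) ^ (n * (n - 1))) := by
        have e1 : (H : ℝ) ^ (n * (n - 1)) = (H : ℝ) ^ ((n : ℝ) ^ 2 - n) := by
          rw [← Real.rpow_natCast]
          congr 1
          rw [Nat.cast_mul, Nat.cast_sub hn]; push_cast; ring
        have e2 : (H : ℝ) ^ ((n : ℝ) ^ 2 + ((k + 1 : ℕ) : ℝ) * n - n - ε) * (H : ℝ) ^ (ε / 2) ≤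
            (H : ℝ) ^ ((1 - η) * r) * (H : ℝ) ^ (n * (n - 1)) := by
          rw [e1, ← Real.rpow_add hH0, ← Real.rpow_add hH0]
          apply Real.rpow_le_rpow_of_exponent_le hH1
          have : (r : ℝ) = n * ((k + 1 : ℕ) : ℝ) := by rw [hr]; push_cast; ring
          have e3 : (1 - η) * (r : ℝ) = r - r * η := by ring
          rw [e3]
          nlinarith
        have e4 : 1 ≤ c * (H : ℝ) ^ (ε / 2) := by
          have := mul_le_mul_of_nonneg_left h2 hc0.le
          rwa [mul_inv_cancel₀ hc0.ne'] at this
        have hpos : 0 ≤ (H : ℝ) ^ ((n : ℝ) ^ 2 + ((k + 1 : ℕ) : ℝ) * n - n - ε) := by positivity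
        calc _ ≤ (c * (H : ℝ) ^ (ε / 2)) *
              (H : ℝ) ^ ((n : ℝ) ^ 2 + ((k + 1 : ℕ) : ℝ) * n - n - ε) :=
              le_mul_of_one_le_left hpos e4
          _ = c * ((H : ℝ) ^ ((n : ℝ) ^ 2 + ((k + 1 : ℕ) : ℝ) * n - n - ε) *
              (H : ℝ) ^ (ε / 2)) := by ring
          _ ≤ _ := mul_le_mul_of_nonneg_left e2 hc0.le
    _ = x ^ n * (H : ℝ) ^ (n * (n - 1)) * ((1 / 2) ^ k / (k.factorial : ℝ) * x ^ k) ^ n := by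
        have : (H : ℝ) ^ ((1 - η) * r) = x ^ n * (x ^ k) ^ n := by
          rw [Real.rpow_mul hH0.le, Real.rpow_natCast, ← pow_mul, ← pow_add, hr]
          congr 1; ring
        rw [this, mul_pow, ← hc]
        ring
    _ ≤ _ := by
        gcongr
        linarith

/-! ### The exponent -/

theorem one_lt_div_log {x : ℝ} (hx : 1 < x) : 1 < (x - 1) / Real.log x := by
  rw [lt_div_iff₀ (Real.log_pos hx), one_mul]
  exact Real.log_lt_sub_one_of_pos (by linarith) hx.ne'

theorem div_log_lt_self {x : ℝ} (hx : 1 < x) : (x - 1) / Real.log x < x := by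
  have h := Real.log_lt_sub_one_of_pos (x := x⁻¹) (by positivity)
    (by rw [ne_eq, inv_eq_one]; exact hx.ne')
  rw [Real.log_inv] at h
  rw [div_lt_iff₀ (Real.log_pos hx)]
  have h2 : x * x⁻¹ = 1 := mul_inv_cancel₀ (by linarith)
  nlinarith

theorem one_div_log_rhoConst {m : ℕ} (hm : 2 ≤ m) :
    1 / Real.log (rhoConst m) = ((m : ℝ) - 1) / Real.log m := by
  have h0 : (0 : ℝ) < m := by positivity
  rw [rhoConst, Real.log_rpow h0, one_div_mul_eq_div, one_div_div]

/-- The upper bound with a factor `(log H) ^ (1 / 2)` to spare. -/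
theorem eventually_ncard_productSet_le {m n : ℕ} (hm : 2 ≤ m) (hn : 1 ≤ n) :
    ∃ C : ℝ, 0 ≤ C ∧ ∀ᶠ H : ℕ in atTop, ((productSet m n H).ncard : ℝ) ≤
      C * ((H : ℝ) ^ (m * n ^ 2) *
        Real.exp (-(logEntropy (1 / Real.log (rhoConst m)) - 1 / 2) * Real.log (Real.log H))) := by
  have hm1 : (1 : ℝ) < m := by exact_mod_cast hm
  rw [one_div_log_rhoConst hm]
  set u := ((m : ℝ) - 1) / Real.log m with hu
  have hexp : ∀ᶠ L : ℝ in atTop,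
      (n : ℝ) ^ 2 * Real.log 2 + 1 + 4 * L ≤ Real.exp L / 2 := by
    filter_upwards [(Real.tendsto_exp_div_pow_atTop 1).eventually_ge_atTop 16,
      eventually_ge_atTop ((n : ℝ) ^ 2 * Real.log 2 + 1), eventually_gt_atTop 0] with L h1 h2 h3
    rw [pow_one, le_div_iff₀ h3] at h1
    linarith
  have hall := (eventually_exists_primes (a := |logEntropy u| + 1) (ε := 1 / (4 * m : ℝ))
    (by positivity) (by positivity)).and (hexp.and (eventually_ge_atTop (4 * (m : ℝ) + 18)))
  have hloglog : Tendsto (fun H : ℕ => Real.log (Real.log H)) atTop atTop :=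
    Real.tendsto_log_atTop.comp (Real.tendsto_log_atTop.comp tendsto_natCast_atTop_atTop)
  refine ⟨32 * m ^ 2 * 3 ^ (m * n ^ 2) + (3 * n ^ (m - 1)) ^ (n ^ 2) * 2 * Real.exp m +
    3 ^ (m * n ^ 2) * 3 ^ m * m, by positivity, ?_⟩
  · filter_upwards [hloglog.eventually hall, eventually_ge_atTop 2]
      with H ⟨⟨Pr, hPr, hlo, hup⟩, hL, hLm⟩ hH
    have hlogH : 0 < Real.log H := Real.log_pos (by exact_mod_cast hH)
    have hHL : (H : ℝ) = Real.exp (Real.exp (Real.log (Real.log H))) := by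
      rw [Real.exp_log hlogH, Real.exp_log (by positivity)]
    exact ncard_productSet_le_of_primes hm hn (one_lt_div_log hm1) (div_log_lt_self hm1)
      (div_mul_cancel₀ _ (Real.log_pos hm1).ne') hHL hPr hlo hup hLm hL

/-- For `m ≥ 6` the argument of the entropy is at least `e`, where `u log u - u` changes sign. -/
theorem one_le_logEntropy {m : ℕ} (hm : 6 ≤ m) :
    1 ≤ logEntropy (1 / Real.log (rhoConst m)) := by
  have hm6 : (6 : ℝ) ≤ m := by exact_mod_cast hm
  rw [one_div_log_rhoConst (by omega)]
  set u := ((m : ℝ) - 1) / Real.log m with hu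
  have hlogm : 0 < Real.log m := Real.log_pos (by linarith)
  have hlog6 : Real.log 6 ≤ 1.83 := by
    rw [Real.log_le_iff_le_exp (by norm_num)]
    have h1 : (2.7182818283 : ℝ) < Real.exp 1 := Real.exp_one_gt_d9
    have h2 : (1 : ℝ) + 0.83 + 0.83 ^ 2 / 2 + 0.83 ^ 3 / 6 ≤ Real.exp 0.83 := by
      have := Real.sum_le_exp_of_nonneg (x := 0.83) (by norm_num) 4
      norm_num [Finset.sum_range_succ, Nat.factorial] at this ⊢
      linarith
    have h3 : Real.exp 1.83 = Real.exp 1 * Real.exp 0.83 := by rw [← Real.exp_add]; norm_num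
    rw [h3]
    nlinarith [Real.exp_pos 1]
  have hlogm_le : Real.log m ≤ 1.83 + (m - 6) / 6 := by
    have h1 : Real.log m = Real.log 6 + Real.log (m / 6) := by
      rw [← Real.log_mul (by norm_num) (by positivity)]; congr 1; field_simp
    have h2 := Real.log_le_sub_one_of_pos (x := (m : ℝ) / 6) (by positivity)
    linarith
  have he : Real.exp 1 ≤ u := by
    rw [hu, le_div_iff₀ hlogm]
    have h1 : Real.exp 1 ≤ 2.7182818286 := Real.exp_one_lt_d9.le
    calc Real.exp 1 * Real.log m ≤ 2.7182818286 * (1.83 + (m - 6) / 6) := by gcongr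
      _ ≤ m - 1 := by linarith
  have hu0 : 0 < u := lt_of_lt_of_le (Real.exp_pos 1) he
  have hlogu : 1 ≤ Real.log u := by rwa [Real.le_log_iff_exp_le hu0]
  rw [logEntropy]
  nlinarith

/-! ### The size of the product set -/

theorem theorem2p3 (m n : ℕ) (hm : 2 ≤ m) (hn : 2 ≤ n) :
    (∃ θ : ℕ → ℝ, Tendsto θ atTop (𝓝 0) ∧
      ∀ H : ℕ, 1 ≤ H →
        (H : ℝ) ^ ((n : ℝ) ^ 2 + (m : ℝ) * (n : ℝ) - (n : ℝ) + θ H) ≤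
          ((productSet m n H).ncard : ℝ)) ∧
    ((fun H : ℕ => ((productSet m n H).ncard : ℝ)) =O[atTop]
      fun H : ℕ => (H : ℝ) ^ (m * n ^ 2) /
        (Real.log H ^ (logEntropy (1 / Real.log (rhoConst m)) - 1) *
          Real.log (Real.log H) ^ ((3 : ℝ) / 2))) ∧
    (6 ≤ m →
      (fun H : ℕ => ((productSet m n H).ncard : ℝ)) =o[atTop]
        fun H : ℕ => (H : ℝ) ^ (m * n ^ 2)) := by
  have hloglog : Tendsto (fun H : ℕ => Real.log (Real.log H)) atTop atTop :=
    Real.tendsto_log_atTop.comp (Real.tendsto_log_atTop.comp tendsto_natCast_atTop_atTop)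
  obtain ⟨C, hC0, hC⟩ := eventually_ncard_productSet_le (m := m) (n := n) hm (by omega)
  refine ⟨?_, ?_, fun hm6 => ?_⟩
  · set E : ℝ := (n : ℝ) ^ 2 + (m : ℝ) * (n : ℝ) - (n : ℝ) with hE
    have hpos : ∀ H : ℕ, 1 ≤ (productSet m n H).ncard := by
      intro H
      refine (Set.ncard_pos (productSet_finite m n H)).mpr ?_
      exact ⟨_, fun _ => 0, fun _ _ _ => by simp, rfl⟩
    -- Capping the true exponent at `E` leaves only the lower bound for `θ` to be shown.
    refine ⟨fun H => min 0 (Real.log (productSet m n H).ncard / Real.log H - E), ?_,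
      fun H hH => ?_⟩
    · rw [Metric.tendsto_nhds]
      intro ε hε
      filter_upwards [eventually_rpow_le_ncard_productSet (m := m) (n := n) (by omega) (by omega)
        (half_pos hε), eventually_ge_atTop 2] with H h1 hH
      have hlogH : 0 < Real.log H := Real.log_pos (by exact_mod_cast hH)
      have h2 := Real.log_le_log (by positivity) h1
      rw [Real.log_rpow (by positivity), ← le_div_iff₀ hlogH] at h2
      rw [Real.dist_eq, sub_zero, abs_of_nonpos (min_le_left _ _), neg_lt]
      exact lt_min (by linarith) (by linarith)
    · have hncard : (1 : ℝ) ≤ (productSet m n H).ncard := by exact_mod_cast hpos H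
      rcases Nat.lt_or_ge 1 H with h1 | h1
      · have hH1 : (1 : ℝ) < H := by exact_mod_cast h1
        have hlogH : 0 < Real.log H := Real.log_pos hH1
        calc (H : ℝ) ^ (E + min 0 (Real.log (productSet m n H).ncard / Real.log H - E))
            ≤ (H : ℝ) ^ (Real.log (productSet m n H).ncard / Real.log H) := by
              apply Real.rpow_le_rpow_of_exponent_le hH1.le
              linarith [min_le_right 0 (Real.log (productSet m n H).ncard / Real.log H - E)]
          _ = (productSet m n H).ncard := by
              rw [Real.rpow_def_of_pos (by linarith), mul_div_cancel₀ _ hlogH.ne',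
                Real.exp_log (by linarith)]
      · -- Here `log H = 0`, but `1` to any power is `1`.
        have : H = 1 := by omega
        subst this
        simpa using hncard
  · set Q := logEntropy (1 / Real.log (rhoConst m)) with hQ
    have hsmall := (tendsto_rpow_mul_exp_neg_mul_atTop_nhds_zero (3 / 2) (1 / 2)
      (by norm_num)).comp hloglog
    refine IsBigO.of_bound C ?_
    filter_upwards [hC, hsmall.eventually_le_const zero_lt_one, hloglog.eventually_gt_atTop 0,
      eventually_ge_atTop 2] with H h1 h2 hL hH
    have hlogH : 0 < Real.log H := Real.log_pos (by exact_mod_cast hH)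
    simp only [Function.comp_apply] at h2
    set L := Real.log (Real.log H) with hLdef
    have hpow : 0 < L ^ ((3 : ℝ) / 2) := Real.rpow_pos_of_pos hL _
    rw [Real.rpow_def_of_pos hlogH, ← hLdef, Real.norm_of_nonneg (Nat.cast_nonneg _),
      Real.norm_of_nonneg (by positivity)]
    refine h1.trans (mul_le_mul_of_nonneg_left ?_ hC0)
    rw [le_div_iff₀ (by positivity), mul_assoc]
    refine mul_le_of_le_one_right (by positivity) ?_
    calc Real.exp (-(Q - 1 / 2) * L) * (Real.exp (L * (Q - 1)) * L ^ ((3 : ℝ) / 2))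
        = L ^ ((3 : ℝ) / 2) * (Real.exp (-(Q - 1 / 2) * L) * Real.exp (L * (Q - 1))) := by ring
      _ = L ^ ((3 : ℝ) / 2) * Real.exp (-(1 / 2) * L) := by
          rw [← Real.exp_add]; congr 2; ring
      _ ≤ 1 := h2
  · have hQ := one_le_logEntropy hm6
    set Q := logEntropy (1 / Real.log (rhoConst m))
    have hsmall : Tendsto (fun H : ℕ => C * Real.exp (-(Q - 1 / 2) * Real.log (Real.log H)))
        atTop (𝓝 0) := by
      have h1 : Tendsto (fun H : ℕ => -(Q - 1 / 2) * Real.log (Real.log H)) atTop atBot :=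
        hloglog.const_mul_atTop_of_neg (by linarith)
      simpa using (Real.tendsto_exp_atBot.comp h1).const_mul C
    refine IsLittleO.of_bound fun c hc => ?_
    filter_upwards [hC, hsmall.eventually_le_const hc] with H h1 h2
    rw [Real.norm_of_nonneg (Nat.cast_nonneg _), Real.norm_of_nonneg (by positivity)]
    refine h1.trans ?_
    calc _ = (C * Real.exp (-(Q - 1 / 2) * Real.log (Real.log H))) * (H : ℝ) ^ (m * n ^ 2) := by
          ring
      _ ≤ _ := by gcongr
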